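/- All Lie algebras are real and finite-dimensional. A symplectic Lie algebra $(\mathfrak g,\omega)$ is a Lie algebra with a non-degenerate skew-symmetric bilinear form $\omega$ such that $-\omega([X,Y],Z)+\omega([X,Z],Y)-\omega([Y,Z],X)=0$ for all $X,Y,Z\in\mathfrak g$; an isomorphism of symplectic Lie algebras is a Lie algebra isomorphism $\varphi$ with $\varphi^*\omega_2=\omega_1$. Let $\mathfrak z$ be the center of $\mathfrak g$, let $\perp$ denote the orthogonal complement with respect to $\omega$, and let $\mathfrak j=\mathfrak z\cap\mathfrak z^\perp$. Then $\mathfrak j$ and $\mathfrak j^\perp$ are ideals, and $\omega$ induces a symplectic form $\overline\omega$ on $\mathfrak j^\perp/\mathfrak j$. The center is degenerate if $\omega|_{\mathfrak z\times\mathfrak z}$ is degenerate. Let $\mathfrak l$ be a finite-dimensional real vector space (an abelian Lie algebra) and $(\mathfrak a,\omega_{\mathfrak a})$ a symplectic Lie algebra. Consider triples $(\gamma,\epsilon,\xi)$ of linear maps $\gamma:\mathfrak l\to\operatorname{Hom}(\mathfrak a,\mathfrak l^*)$, $\xi:\mathfrak l\to\operatorname{Hom}(\mathfrak a,\mathfrak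 a)$ and an alternating bilinear map $\epsilon:\mathfrak l\times\mathfrak l\to\mathfrak l^*$. For such a triple let $\beta:\mathfrak a\times\mathfrak a\to\mathfrak l^*$ and $\alpha:\mathfrak l\times\mathfrak l\to\mathfrak a$ be given by $$\beta(A_1,A_2)(L)=-\omega_{\mathfrak a}(\xi(L)A_1,A_2)-\omega_{\mathfrak a}(A_1,\xi(L)A_2),$$ $$\omega_{\mathfrak a}(\alpha(L_1,L_2),A)=(\gamma(L_1)A)(L_2)-(\gamma(L_2)A)(L_1).$$ Let $Z^2(\mathfrak l,\mathfrak a,\omega_{\mathfrak a})$ be the set of triples such that, for all $L,L_i\in\mathfrak l$ and $A,A_i\in\mathfrak a$: 1. each $\xi(L)$ is a derivation of $\mathfrak a$, $[\xi(L_1),\xi(L_2)]=\operatorname{ad}(\alpha(L_1,L_2))$, and $\xi(L_1)\alpha(L_2,L_3)+\xi(L_2)\alpha(L_3,L_1)+\xi(L_3)\alpha(L_1,L_2)=0$; 2. $\beta(\xi(L)A_1,A_2)+\beta(A_1,\xi(L)A_2)=\gamma(L)[A_1,A_2]$; 3. $\gamma(L_2)\xi(L_1)A-\gamma(L_1)\xi(L_2)A+\beta(\alpha(L_1,L_2),A)=0$;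 4. $\gamma(L_1)\alpha(L_2,L_3)+\gamma(L_2)\alpha(L_3,L_1)+\gamma(L_3)\alpha(L_1,L_2)=0$; 5. $\epsilon(L_1,L_2)L_3+\epsilon(L_2,L_3)L_1+\epsilon(L_3,L_1)L_2=0$. Such a triple is balanced, written $(\gamma,\epsilon,\xi)\in Z^2(\mathfrak l,\mathfrak a,\omega_{\mathfrak a})_\sharp$, if (a) the only $L\in\mathfrak l$ for which there is an $A\in\mathfrak a$ with $\operatorname{ad}(A)+\xi(L)=0$, $\gamma(L)+\beta(A,\cdot)=0$, $\alpha(L,\cdot)=\xi(\cdot)A$ and $\epsilon(L,\cdot)=\gamma(\cdot)A$ is $L=0$; and (b) $\omega_{\mathfrak a}$ is non-degenerate on the subspace of all $A$ in the center of $\mathfrak a$ with $\beta(A,\cdot)=0$, $\xi(\cdot)A=0$ and $\gamma(\cdot)A=0$. For linear $\tau:\mathfrak l\to\mathfrak a$ put $(\tau^*A)(L)=\omega_{\mathfrak a}(\tau L,A)$. The group $C^1(\mathfrak l,\mathfrak a)=\operatorname{Hom}(\mathfrak l,\mathfrak a)$ acts on the set of triples by $(\gamma,\epsilon,\xi)\tau=(\gamma',\epsilon',\xi')$,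 where $$\xi'(L)A=\xi(L)A-[\tau L,A],\qquad \gamma'(L)A=\gamma(L)A+\tau^*(\xi(L)A)-\tau^*[\tau L,A]-\beta(\tau L,A),$$ $$\epsilon'(L_1,L_2)=\epsilon(L_1,L_2)+\tau^*\alpha(L_1,L_2)-\gamma(L_1)\tau L_2+\gamma(L_2)\tau L_1-\tau^*\big(\xi(L_1)\tau L_2-\xi(L_2)\tau L_1\big)+\beta(\tau L_1,\tau L_2)+\tau^*[\tau L_1,\tau L_2].$$ Let $H^2(\mathfrak l,\mathfrak a,\omega_{\mathfrak a})_\sharp=Z^2(\mathfrak l,\mathfrak a,\omega_{\mathfrak a})_\sharp/C^1(\mathfrak l,\mathfrak a)$ be the set of classes $[\gamma,\epsilon,\xi]$ of balanced triples. The group $G=G(\mathfrak l,\mathfrak a,\omega_{\mathfrak a})$ of pairs $(S,U)$ of a linear automorphism $S$ of $\mathfrak l$ and an automorphism $U$ of the symplectic Lie algebra $(\mathfrak a,\omega_{\mathfrak a})$ acts on it by pull back, $(S,U)^*[\gamma,\epsilon,\xi]=[\gamma'',\epsilon'',\xi'']$ with $\gamma''(L)A=\gamma(SL)(U^{-1}A)\circ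 S$, $\epsilon''(L_1,L_2)=\epsilon(SL_1,SL_2)\circ S$ and $\xi''(L)=U\circ\xi(SL)\circ U^{-1}$. For $(\gamma,\epsilon,\xi)\in Z^2(\mathfrak l,\mathfrak a,\omega_{\mathfrak a})$ let $\mathfrak d_{\gamma,\epsilon,\xi}(\mathfrak l,\mathfrak a)$ be the symplectic Lie algebra $\mathfrak l^*\oplus\mathfrak a\oplus\mathfrak l$ in which $\mathfrak l^*$ is central, $[A_1,A_2]=\beta(A_1,A_2)+[A_1,A_2]_{\mathfrak a}$, $[L,A]=\gamma(L)A+\xi(L)A$, $[L_1,L_2]=\epsilon(L_1,L_2)+\alpha(L_1,L_2)$, and $\omega(Z_1+A_1+L_1,Z_2+A_2+L_2)=Z_1(L_2)+\omega_{\mathfrak a}(A_1,A_2)-Z_2(L_1)$. **Theorem.** (i) Let $(\mathfrak a,\omega_{\mathfrak a})$ be a symplectic Lie algebra and $n\ge 0$. The map $(\gamma,\epsilon,\xi)\mapsto\mathfrak d_{\gamma,\epsilon,\xi}(\mathbb R^n,\mathfrak a)$ induces a bijection from the orbit space $H^2(\mathbb R^n,\mathfrak a,\omega_{\mathfrak a})_\sharp/G$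 onto the set of isomorphism classes of symplectic Lie algebras for which $\mathfrak j=\mathfrak z\cap\mathfrak z^\perp$ is $n$-dimensional and $(\mathfrak j^\perp/\mathfrak j,\overline\omega)$ is isomorphic to $(\mathfrak a,\omega_{\mathfrak a})$. (ii) For each $d\ge 0$ let $\operatorname{Isom}(2d)$ be a system of representatives of the isomorphism classes of $2d$-dimensional symplectic Lie algebras. For every $n\ge 0$ the same map induces a bijection from $$\coprod_{m=1}^{n}\ \coprod_{(\mathfrak a,\omega_{\mathfrak a})\in\operatorname{Isom}(2n-2m)}H^2(\mathbb R^m,\mathfrak a,\omega_{\mathfrak a})_\sharp/G$$ onto the set of isomorphism classes of $2n$-dimensional symplectic Lie algebras with degenerate center. -/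

import Mathlib

universe u v w

noncomputable section

/-! ### Symplectic Lie algebras -/

/-- A (finite-dimensional, real) symplectic Lie algebra: a real Lie algebra together with a
skew-symmetric, non-degenerate bilinear form `ω` which is closed. -/
structure SymplecticLieAlgebra where
  carrier : Type u
  [lieRing : LieRing carrier]
  [lieAlgebra : LieAlgebra ℝ carrier]
  [finiteDimensional : FiniteDimensional ℝ carrier]
  form : LinearMap.BilinForm ℝ carrier
  isAlt : form.IsAlt
  nondegenerate : form.Nondegenerate
  closed : ∀ x y z : carrier, -form ⁅x, y⁆ z + form ⁅x, z⁆ y - form ⁅y, z⁆ x = 0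

namespace SymplecticLieAlgebra

instance : CoeSort SymplecticLieAlgebra.{u} (Type u) := ⟨carrier⟩

attribute [instance] lieRing lieAlgebra finiteDimensional

/-- An isomorphism of symplectic Lie algebras: an isomorphism `φ` of Lie algebras with
`φ^* ω_B = ω_A`. -/
structure Iso (A : SymplecticLieAlgebra.{u}) (B : SymplecticLieAlgebra.{v}) extends
    A ≃ₗ⁅ℝ⁆ B where
  map_form : ∀ x y : A, B.form (toLieEquiv x) (toLieEquiv y) = A.form x y

/-- The identity isomorphism. -/
def Iso.refl (A : SymplecticLieAlgebra.{u}) : Iso A A where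
  toLieEquiv := LieEquiv.refl
  map_form _ _ := rfl

/-- The inverse isomorphism. -/
def Iso.symm {A : SymplecticLieAlgebra.{u}} {B : SymplecticLieAlgebra.{v}} (e : Iso A B) :
    Iso B A where
  toLieEquiv := e.toLieEquiv.symm
  map_form x y := by
    rw [← e.map_form]; simp

/-- Composition of isomorphisms. -/
def Iso.trans {A : SymplecticLieAlgebra.{u}} {B : SymplecticLieAlgebra.{v}}
    {C : SymplecticLieAlgebra.{w}} (e : Iso A B) (f : Iso B C) : Iso A C where
  toLieEquiv := e.toLieEquiv.trans f.toLieEquiv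
  map_form x y := by
    rw [← e.map_form, ← f.map_form]; rfl

/-- Two symplectic Lie algebras are equivalent if they are isomorphic. -/
instance isoSetoid : Setoid SymplecticLieAlgebra.{u} where
  r A B := Nonempty (Iso A B)
  iseqv := ⟨fun A => ⟨Iso.refl A⟩, fun ⟨e⟩ => ⟨e.symm⟩, fun ⟨e⟩ ⟨f⟩ => ⟨e.trans f⟩⟩

/-- Isomorphism classes of symplectic Lie algebras. -/
def IsoClass : Type (u + 1) := Quotient isoSetoid.{u}

/-- The isomorphism class of a symplectic Lie algebra. -/
def isoClass (A : SymplecticLieAlgebra.{u}) : IsoClass.{u} := Quotient.mk isoSetoid A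

/-- A system of representatives of the isomorphism classes of `d`-dimensional symplectic Lie
algebras. -/
def IsSystemOfRepresentatives (d : ℕ) (R : Set SymplecticLieAlgebra.{u}) : Prop :=
  (∀ A ∈ R, Module.finrank ℝ A = d) ∧
    ∀ B : SymplecticLieAlgebra.{u}, Module.finrank ℝ B = d → ∃! A, A ∈ R ∧ Nonempty (Iso B A)

variable (A : SymplecticLieAlgebra.{u})

/-- A subspace is non-degenerate if the restriction of `ω` to it is non-degenerate. -/
def NondegenerateOn (W : Submodule ℝ A) : Prop := (A.form.restrict W).Nondegenerate

/-- The center of `A` is degenerate with respect to `ω`. -/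
def HasDegenerateCenter : Prop := ¬ A.NondegenerateOn (LieAlgebra.center ℝ A).toSubmodule

variable {A} in
lemma form_swap (x y : A) : A.form x y = -A.form y x := (A.isAlt.neg_eq y x).symm

variable {A} in
lemma form_lie_of_mem_center (x y : A) {z : A} (hz : z ∈ LieAlgebra.center ℝ A) :
    A.form z ⁅x, y⁆ = 0 := by
  have h := A.closed x y z
  have hx : ⁅x, z⁆ = 0 := hz x
  have hy : ⁅y, z⁆ = 0 := hz y
  rw [hx, hy] at h
  rw [form_swap]
  simpa using h

/-- The orthogonal complement `I^⊥` with respect to `ω` of a central ideal `I`; it is an ideal. -/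
def orthIdeal (I : LieIdeal ℝ A) (hI : I ≤ LieAlgebra.center ℝ A) : LieIdeal ℝ A where
  toSubmodule := A.form.orthogonal I.toSubmodule
  lie_mem {x m} _ := by
    intro z hz
    exact form_lie_of_mem_center x m (hI hz)

/-- The canonical ideal `j = z ∩ z^⊥`, where `z` is the center. -/
def canonicalIdeal : LieIdeal ℝ A :=
  LieAlgebra.center ℝ A ⊓ A.orthIdeal (LieAlgebra.center ℝ A) le_rfl

/-- The ideal `j^⊥`. -/
def canonicalPerp : LieIdeal ℝ A := A.orthIdeal A.canonicalIdeal inf_le_left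

/-- `j`, viewed as an ideal of the Lie algebra `j^⊥`. -/
def canonicalIdealInPerp : LieIdeal ℝ A.canonicalPerp :=
  LieIdeal.comap A.canonicalPerp.incl A.canonicalIdeal

lemma form_eq_zero_of_mem_perp {x y : A} (hx : x ∈ A.canonicalIdeal)
    (hy : y ∈ A.canonicalPerp) : A.form x y = 0 := hy x hx

/-- The bilinear form on `j^⊥ / j` induced by `ω`. -/
def reductionForm : LinearMap.BilinForm ℝ (A.canonicalPerp ⧸ A.canonicalIdealInPerp) :=
  Submodule.liftQ A.canonicalIdealInPerp.toSubmodule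
    ((Submodule.liftQ A.canonicalIdealInPerp.toSubmodule
      (A.form.restrict A.canonicalPerp.toSubmodule).flip (by
        intro x hx
        ext y
        change A.form y.1 x.1 = 0
        rw [form_swap, A.form_eq_zero_of_mem_perp (x := x.1) hx y.2, neg_zero])).flip) (by
    intro x hx
    refine LinearMap.ext fun y => ?_
    obtain ⟨y, rfl⟩ := Submodule.Quotient.mk_surjective _ y
    exact A.form_eq_zero_of_mem_perp (x := x.1) hx y.2)

lemma reductionForm_mk (x y : A.canonicalPerp) :
    A.reductionForm (LieSubmodule.Quotient.mk x) (LieSubmodule.Quotient.mk y) =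
      A.form x.1 y.1 := rfl

lemma reductionForm_isAlt : A.reductionForm.IsAlt := by
  intro x
  obtain ⟨x, rfl⟩ := Submodule.Quotient.mk_surjective _ x
  exact A.isAlt x.1

/-- The symplectic Lie algebra `j^⊥ / j` with the form induced by `ω`. -/
def reduction : SymplecticLieAlgebra.{u} where
  carrier := A.canonicalPerp ⧸ A.canonicalIdealInPerp
  finiteDimensional :=
    inferInstanceAs (FiniteDimensional ℝ
      (A.canonicalPerp ⧸ A.canonicalIdealInPerp.toSubmodule))
  form := A.reductionForm
  isAlt := A.reductionForm_isAlt
  nondegenerate := by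
    refine (LinearMap.IsRefl.nondegenerate_iff_separatingLeft
      A.reductionForm_isAlt.isRefl).2 ?_
    intro x hx
    obtain ⟨x, rfl⟩ := Submodule.Quotient.mk_surjective _ x
    refine (Submodule.Quotient.mk_eq_zero _).2 ?_
    have h : x.1 ∈ A.form.orthogonal (A.form.orthogonal A.canonicalIdeal.toSubmodule) := by
      intro y hy
      have := hx (LieSubmodule.Quotient.mk ⟨y, hy⟩)
      change A.form x.1 y = 0 at this
      change A.form y x.1 = 0
      rw [form_swap, this, neg_zero]
    rw [LinearMap.BilinForm.orthogonal_orthogonal A.nondegenerate A.isAlt.isRefl] at h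
    exact h
  closed x y z := by
    obtain ⟨x, rfl⟩ := Submodule.Quotient.mk_surjective _ x
    obtain ⟨y, rfl⟩ := Submodule.Quotient.mk_surjective _ y
    obtain ⟨z, rfl⟩ := Submodule.Quotient.mk_surjective _ z
    exact A.closed x.1 y.1 z.1

/-- The dual map `f^* : l → a` of a linear map `f : a → l^*`, given by
`(f a) L = ω (f^* L) a`. -/
def dualOfToDual {l : Type w} [AddCommGroup l] [Module ℝ l] (f : A →ₗ[ℝ] Module.Dual ℝ l) :
    l →ₗ[ℝ] A :=
  (A.form.toDual A.nondegenerate).symm.toLinearMap ∘ₗ f.flip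

/-- The dual map `τ^* : a → l^*` of a linear map `τ : l → a`, given by
`(τ^* a) L = ω (τ L) a`. -/
def dualOfFrom {l : Type w} [AddCommGroup l] [Module ℝ l] (τ : l →ₗ[ℝ] A) :
    A →ₗ[ℝ] Module.Dual ℝ l :=
  (A.form ∘ₗ τ).flip

variable {A} in
@[simp]
lemma form_dualOfToDual {l : Type w} [AddCommGroup l] [Module ℝ l]
    (f : A →ₗ[ℝ] Module.Dual ℝ l) (L : l) (a : A) :
    A.form (A.dualOfToDual f L) a = f a L := by
  simp [dualOfToDual]

variable {A} in
@[simp]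
lemma dualOfFrom_apply {l : Type w} [AddCommGroup l] [Module ℝ l]
    (τ : l →ₗ[ℝ] A) (a : A) (L : l) : A.dualOfFrom τ a L = A.form (τ L) a := rfl

end SymplecticLieAlgebra

open SymplecticLieAlgebra

/-! ### Quadratic cochains and cocycles -/

/-- Triples `(γ, ε, ξ)` of linear maps `γ : l → Hom(a, l^*)`, `ξ : l → Hom(a)` and an
alternating bilinear map `ε` on `l` with values in `l^*`. Here `l` is a vector space, regarded as
an abelian Lie algebra. -/
@[ext]
structure QuadraticCochain (l : Type w) [AddCommGroup l] [Module ℝ l]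
    (A : SymplecticLieAlgebra.{u}) where
  γ : l →ₗ[ℝ] A →ₗ[ℝ] Module.Dual ℝ l
  ε : l →ₗ[ℝ] l →ₗ[ℝ] Module.Dual ℝ l
  ξ : l →ₗ[ℝ] A →ₗ[ℝ] A
  ε_self : ∀ L : l, ε L L = 0

namespace QuadraticCochain

section

variable {l : Type w} [AddCommGroup l] [Module ℝ l] {A : SymplecticLieAlgebra.{u}}
  (c : QuadraticCochain l A)

/-- The `2`-form `β` on `a` with values in `l^*`. -/
def β : A →ₗ[ℝ] A →ₗ[ℝ] Module.Dual ℝ l :=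
  LinearMap.mk₂ ℝ
    (fun a b => -(A.form.flip b ∘ₗ c.ξ.flip a) - A.form a ∘ₗ c.ξ.flip b)
    (fun a a' b => by ext L; simp; ring)
    (fun r a b => by ext L; simp; ring)
    (fun a b b' => by ext L; simp; ring)
    (fun r a b => by ext L; simp; ring)

@[simp]
lemma β_apply (a b : A) (L : l) :
    c.β a b L = -A.form (c.ξ L a) b - A.form a (c.ξ L b) := rfl

/-- The `2`-form `α` on `l` with values in `a`, given by
`α(L₁, L₂) = (γ L₁)^* L₂ - (γ L₂)^* L₁`. -/
def α (L₁ L₂ : l) : A := A.dualOfToDual (c.γ L₁) L₂ - A.dualOfToDual (c.γ L₂) L₁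

/-- The conditions defining the set `Z²(l, a, ω)` of quadratic cocycles. The first three say that
`(ξ, α)` is a factor system. -/
structure IsCocycle : Prop where
  /-- `ξ` has values in the derivations of `a` -/
  derivation : ∀ (L : l) (a b : A), c.ξ L ⁅a, b⁆ = ⁅c.ξ L a, b⁆ + ⁅a, c.ξ L b⁆
  /-- `dξ + ½ [ξ ∧ ξ] = ad ∘ α`, where `dξ = 0` as `l` is abelian -/
  curvature : ∀ (L₁ L₂ : l) (a : A),
    c.ξ L₁ (c.ξ L₂ a) - c.ξ L₂ (c.ξ L₁ a) = ⁅c.α L₁ L₂, a⁆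
  /-- `d_ξ α = 0` -/
  bianchi : ∀ L₁ L₂ L₃ : l,
    c.ξ L₁ (c.α L₂ L₃) - c.ξ L₂ (c.α L₁ L₃) + c.ξ L₃ (c.α L₁ L₂) = 0
  /-- `β(ξ(L)a, b) + β(a, ξ(L)b) = γ(L)[a, b]` -/
  β_γ : ∀ (L : l) (a b : A), c.β (c.ξ L a) b + c.β a (c.ξ L b) = c.γ L ⁅a, b⁆
  /-- `d_ξ̂ γ + β₀ ∘ α = 0`, where `ξ̂(L) f = f ∘ ξ(L)` -/
  dγ : ∀ (L₁ L₂ : l) (a : A),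
    c.γ L₂ (c.ξ L₁ a) - c.γ L₁ (c.ξ L₂ a) + c.β (c.α L₁ L₂) a = 0
  /-- `ev(γ ∧ α) = 0` -/
  γ_α : ∀ L₁ L₂ L₃ : l,
    c.γ L₁ (c.α L₂ L₃) + c.γ L₂ (c.α L₃ L₁) + c.γ L₃ (c.α L₁ L₂) = 0
  /-- the cyclic sum of `ε(L₁, L₂) L₃` vanishes -/
  ε_cyclic : ∀ L₁ L₂ L₃ : l, c.ε L₁ L₂ L₃ + c.ε L₂ L₃ L₁ + c.ε L₃ L₁ L₂ = 0

/-- The subspace `z(a) ∩ ker β₀ ∩ ker ξ₀ ∩ ker γ₀` of `a`, where `β₀(a) = β(a, ·)`,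
`ξ₀(a) L = ξ(L) a` and `γ₀(a) L = γ(L) a`. -/
def balancedSubspace : Submodule ℝ A :=
  (LieAlgebra.center ℝ A).toSubmodule ⊓ LinearMap.ker c.β ⊓ LinearMap.ker c.ξ.flip ⊓
    LinearMap.ker c.γ.flip

/-- The balanced quadratic cocycles, forming the set `Z²(l, a, ω)_♯`. -/
structure IsBalancedCocycle : Prop extends c.IsCocycle where
  condA : ∀ (L : l) (a : A),
    (∀ b : A, ⁅a, b⁆ + c.ξ L b = 0) →
    (∀ b : A, c.γ L b + c.β a b = 0) →
    (∀ L' : l, c.α L L' = c.ξ L' a) →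
    (∀ L' : l, c.ε L L' = c.γ L' a) → L = 0
  condB : A.NondegenerateOn c.balancedSubspace

variable {c} in
lemma ε_swap (L₁ L₂ : l) : c.ε L₁ L₂ = -c.ε L₂ L₁ := by
  have h := c.ε_self (L₁ + L₂)
  simp only [map_add, LinearMap.add_apply, c.ε_self, zero_add, add_zero] at h
  exact eq_neg_of_add_eq_zero_right h

lemma form_α (L₁ L₂ : l) (a : A) : A.form (c.α L₁ L₂) a = c.γ L₁ a L₂ - c.γ L₂ a L₁ := by
  simp [α]

end

/-! ### The action of `Hom(l, a)` and the quadratic cohomology -/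

section

variable {l : Type w} [AddCommGroup l] [Module ℝ l] {A : SymplecticLieAlgebra.{u}}

lemma _root_.SymplecticLieAlgebra.eq_of_form {x y : A} (h : ∀ z, A.form x z = A.form y z) :
    x = y := by
  rw [← sub_eq_zero]
  refine A.nondegenerate.1 _ fun z => ?_
  simp [h z]

@[simp]
lemma α_add_left (c : QuadraticCochain l A) (L₁ L₁' L₂ : l) :
    c.α (L₁ + L₁') L₂ = c.α L₁ L₂ + c.α L₁' L₂ := by
  apply eq_of_form; intro z; simp [form_α]; ring

@[simp]
lemma α_smul_left (c : QuadraticCochain l A) (r : ℝ) (L₁ L₂ : l) :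
    c.α (r • L₁) L₂ = r • c.α L₁ L₂ := by
  apply eq_of_form; intro z; simp [form_α]; ring

lemma α_swap (c : QuadraticCochain l A) (L₁ L₂ : l) : c.α L₁ L₂ = -c.α L₂ L₁ := by
  simp [α]

@[simp]
lemma α_self (c : QuadraticCochain l A) (L : l) : c.α L L = 0 := by
  simp [α]

@[simp]
lemma α_add_right (c : QuadraticCochain l A) (L₁ L₂ L₂' : l) :
    c.α L₁ (L₂ + L₂') = c.α L₁ L₂ + c.α L₁ L₂' := by
  apply eq_of_form; intro z; simp [form_α]; ring

@[simp]
lemma α_smul_right (c : QuadraticCochain l A) (r : ℝ) (L₁ L₂ : l) :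
    c.α L₁ (r • L₂) = r • c.α L₁ L₂ := by
  apply eq_of_form; intro z; simp [form_α]; ring

/-- The triple `(γ, ε, ξ)τ` for `τ : l → a` linear:
`γ' = γ + τ^* ∘ ξ - τ^* ∘ ad ∘ τ - β₀ ∘ τ`, `ξ' = ξ - ad ∘ τ` and
`ε' = ε + τ^* α - ev(γ ∧ τ) - τ^* d_ξ τ + ½ β(τ ∧ τ) + ½ τ^* [τ ∧ τ]`. -/
def act (c : QuadraticCochain l A) (τ : l →ₗ[ℝ] A) : QuadraticCochain l A where
  γ := LinearMap.mk₂ ℝ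
    (fun L a => c.γ L a + A.dualOfFrom τ (c.ξ L a) - A.dualOfFrom τ ⁅τ L, a⁆ - c.β (τ L) a)
    (by intros; simp only [map_add, LinearMap.add_apply, add_lie]; abel)
    (by intros; simp only [map_smul, LinearMap.smul_apply, smul_lie, smul_add, smul_sub])
    (by intros; simp only [map_add, lie_add]; abel)
    (by intros; simp only [map_smul, lie_smul, smul_add, smul_sub])
  ε := LinearMap.mk₂ ℝ
    (fun L₁ L₂ => c.ε L₁ L₂ + A.dualOfFrom τ (c.α L₁ L₂)
      - (c.γ L₁ (τ L₂) - c.γ L₂ (τ L₁))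
      - A.dualOfFrom τ (c.ξ L₁ (τ L₂) - c.ξ L₂ (τ L₁))
      + c.β (τ L₁) (τ L₂) + A.dualOfFrom τ ⁅τ L₁, τ L₂⁆)
    (by intros; simp only [map_add, map_sub, LinearMap.add_apply, add_lie, α_add_left]; abel)
    (by
      intros
      simp only [map_smul, map_sub, LinearMap.smul_apply, smul_lie, α_smul_left, smul_add,
        smul_sub])
    (by intros; simp only [map_add, map_sub, LinearMap.add_apply, lie_add, α_add_right]; abel)
    (by
      intros
      simp only [map_smul, map_sub, LinearMap.smul_apply, lie_smul, α_smul_right, smul_add,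
        smul_sub])
  ξ := LinearMap.mk₂ ℝ (fun L a => c.ξ L a - ⁅τ L, a⁆)
    (by intros; simp only [map_add, LinearMap.add_apply, add_lie]; abel)
    (by intros; simp only [map_smul, LinearMap.smul_apply, smul_lie, smul_sub])
    (by intros; simp only [map_add, lie_add]; abel)
    (by intros; simp only [map_smul, lie_smul, smul_sub])
  ε_self L := by
    have h : c.β (τ L) (τ L) = 0 := by
      ext L'
      simp only [β_apply, LinearMap.zero_apply]
      rw [form_swap (τ L)]
      ring
    simp [h, c.ε_self]

section

variable (c : QuadraticCochain l A) (τ : l →ₗ[ℝ] A)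

lemma act_γ (L : l) (a : A) : (c.act τ).γ L a =
    c.γ L a + A.dualOfFrom τ (c.ξ L a) - A.dualOfFrom τ ⁅τ L, a⁆ - c.β (τ L) a := rfl

lemma act_ε (L₁ L₂ : l) : (c.act τ).ε L₁ L₂ = c.ε L₁ L₂ + A.dualOfFrom τ (c.α L₁ L₂)
      - (c.γ L₁ (τ L₂) - c.γ L₂ (τ L₁))
      - A.dualOfFrom τ (c.ξ L₁ (τ L₂) - c.ξ L₂ (τ L₁))
      + c.β (τ L₁) (τ L₂) + A.dualOfFrom τ ⁅τ L₁, τ L₂⁆ := rfl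

lemma act_ξ (L : l) (a : A) : (c.act τ).ξ L a = c.ξ L a - ⁅τ L, a⁆ := rfl

lemma closed' (x y z : A) : A.form ⁅x, y⁆ z = -A.form ⁅y, z⁆ x - A.form ⁅z, x⁆ y := by
  have h := A.closed x y z
  rw [← lie_skew z x, map_neg, LinearMap.neg_apply]
  linarith

lemma act_α (L₁ L₂ : l) : (c.act τ).α L₁ L₂ =
    c.α L₁ L₂ - (c.ξ L₁ (τ L₂) - c.ξ L₂ (τ L₁)) + ⁅τ L₁, τ L₂⁆ := by
  apply eq_of_form; intro z
  have h := closed' (τ L₁) (τ L₂) z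
  rw [← lie_skew z (τ L₁)] at h
  have e1 := form_swap ⁅τ L₂, z⁆ (τ L₁)
  have e2 := form_swap ⁅τ L₁, z⁆ (τ L₂)
  have e3 := form_swap (c.ξ L₂ z) (τ L₁)
  simp only [form_α, act_γ, map_add, map_sub, map_neg, LinearMap.add_apply, LinearMap.sub_apply,
    LinearMap.neg_apply, dualOfFrom_apply, β_apply] at *
  linarith

lemma act_β (a b : A) : (c.act τ).β a b = c.β a b + A.dualOfFrom τ ⁅a, b⁆ := by
  ext L
  have h := closed' a b (τ L)
  rw [← lie_skew b (τ L)] at h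
  have e1 := form_swap ⁅a, b⁆ (τ L)
  have e2 := form_swap ⁅τ L, b⁆ a
  simp only [act_ξ, map_sub, map_neg, LinearMap.add_apply, LinearMap.sub_apply,
    LinearMap.neg_apply, dualOfFrom_apply, β_apply] at *
  linarith

lemma act_zero : c.act 0 = c := by
  ext
  · simp [act_γ]
  · simp [act_ε]
  · simp [act_ξ]

lemma act_act (σ : l →ₗ[ℝ] A) : (c.act τ).act σ = c.act (τ + σ) := by
  ext L₁ L₂ L₃
  · simp only [act_γ, act_ξ, act_β, map_add, map_sub, LinearMap.add_apply, LinearMap.sub_apply,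
      dualOfFrom_apply, add_lie]
    ring
  · rw [act_ε, act_ε, act_ε, act_α, act_β, act_γ, act_γ, act_ξ, act_ξ]
    rw [← lie_skew (τ L₂) (σ L₁)]
    have e1 := form_swap (c.ξ L₃ (σ L₁)) (τ L₂)
    have e2 := form_swap (c.ξ L₃ (τ L₂)) (σ L₁)
    simp only [map_add, map_sub, map_neg, LinearMap.add_apply, LinearMap.sub_apply, lie_add,
      add_lie, LinearMap.neg_apply, dualOfFrom_apply, β_apply] at *
    linarith
  · simp only [act_ξ, LinearMap.add_apply, add_lie]
    abel

end

/-- `τ` acts on the set of all triples by `(γ, ε, ξ) ↦ (γ, ε, ξ)τ`. -/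
instance : AddAction (l →ₗ[ℝ] A) (QuadraticCochain l A) where
  vadd τ c := c.act τ
  zero_vadd c := act_zero c
  add_vadd τ σ c := by
    change c.act (τ + σ) = (c.act σ).act τ
    rw [act_act, add_comm]

lemma vadd_def (τ : l →ₗ[ℝ] A) (c : QuadraticCochain l A) : τ +ᵥ c = c.act τ := rfl

end

/-- The orbits of `C¹(l, a) = Hom(l, a)` in the set of all triples `(γ, ε, ξ)`. -/
abbrev CochainClass (l : Type w) [AddCommGroup l] [Module ℝ l] (A : SymplecticLieAlgebra.{u}) :
    Type (max u w) :=
  AddAction.orbitRel.Quotient (l →ₗ[ℝ] A) (QuadraticCochain l A)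

section

variable {l : Type w} [AddCommGroup l] [Module ℝ l] {A : SymplecticLieAlgebra.{u}}

/-- The class `[γ, ε, ξ]`. -/
def cls (c : QuadraticCochain l A) : CochainClass l A :=
  Quotient.mk (AddAction.orbitRel (l →ₗ[ℝ] A) (QuadraticCochain l A)) c

end

/-- The set `H²(l, a, ω)_♯ = Z²(l, a, ω)_♯ / C¹(l, a)` of cohomology classes of balanced
quadratic cocycles. -/
def BalancedCohomology (l : Type w) [AddCommGroup l] [Module ℝ l] (A : SymplecticLieAlgebra.{u}) :
    Type (max u w) :=
  {q : CochainClass l A // ∃ c : QuadraticCochain l A, c.IsBalancedCocycle ∧ c.cls = q}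

/-! ### Pull back along isomorphisms of pairs and the orbit space -/

section

variable {l₁ : Type*} [AddCommGroup l₁] [Module ℝ l₁] {l₂ : Type*} [AddCommGroup l₂] [Module ℝ l₂]
  {l₃ : Type*} [AddCommGroup l₃] [Module ℝ l₃]
  {A₁ A₂ A₃ : SymplecticLieAlgebra.{u}}

lemma _root_.SymplecticLieAlgebra.Iso.form_symm_left (U : Iso A₂ A₁) (x : A₁) (y : A₂) :
    A₂.form (U.toLieEquiv.symm x) y = A₁.form x (U.toLieEquiv y) := by
  rw [← U.map_form]; simp

/-- The pull back `(S, U)^*(γ, ε, ξ)` along a linear isomorphism `S : l₁ → l₂` and an isomorphism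
of symplectic Lie algebras `U : a₂ → a₁`. -/
def pullback (S : l₁ ≃ₗ[ℝ] l₂) (U : Iso A₂ A₁) (c : QuadraticCochain l₂ A₂) :
    QuadraticCochain l₁ A₁ where
  γ := LinearMap.mk₂ ℝ (fun L a => c.γ (S L) (U.toLieEquiv.symm a) ∘ₗ S.toLinearMap)
    (by intros; ext; simp) (by intros; ext; simp) (by intros; ext; simp) (by intros; ext; simp)
  ε := LinearMap.mk₂ ℝ (fun L L' => c.ε (S L) (S L') ∘ₗ S.toLinearMap)
    (by intros; ext; simp) (by intros; ext; simp) (by intros; ext; simp) (by intros; ext; simp)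
  ξ := LinearMap.mk₂ ℝ (fun L a => U.toLieEquiv (c.ξ (S L) (U.toLieEquiv.symm a)))
    (by intros; simp) (by intros; simp) (by intros; simp) (by intros; simp)
  ε_self L := by ext; simp [c.ε_self]

section

variable (S : l₁ ≃ₗ[ℝ] l₂) (U : Iso A₂ A₁) (c : QuadraticCochain l₂ A₂)

lemma pullback_γ (L L' : l₁) (a : A₁) :
    (c.pullback S U).γ L a L' = c.γ (S L) (U.toLieEquiv.symm a) (S L') := rfl

lemma pullback_ε (L₁ L₂ L₃ : l₁) :
    (c.pullback S U).ε L₁ L₂ L₃ = c.ε (S L₁) (S L₂) (S L₃) := rfl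

lemma pullback_ξ (L : l₁) (a : A₁) :
    (c.pullback S U).ξ L a = U.toLieEquiv (c.ξ (S L) (U.toLieEquiv.symm a)) := rfl

lemma pullback_α (L₁ L₂ : l₁) :
    (c.pullback S U).α L₁ L₂ = U.toLieEquiv (c.α (S L₁) (S L₂)) := by
  apply eq_of_form; intro z
  rw [form_α, pullback_γ, pullback_γ, ← form_α, ← U.map_form]
  simp

lemma pullback_β (a b : A₁) (L : l₁) :
    (c.pullback S U).β a b L = c.β (U.toLieEquiv.symm a) (U.toLieEquiv.symm b) (S L) := by
  simp only [β_apply, pullback_ξ]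
  rw [form_swap _ (U.toLieEquiv.symm b), U.form_symm_left, U.form_symm_left, form_swap b]
  ring

lemma pullback_act (τ : l₂ →ₗ[ℝ] A₂) :
    (c.act τ).pullback S U =
      (c.pullback S U).act (U.toLieEquiv.toLinearEquiv.toLinearMap ∘ₗ τ ∘ₗ S.toLinearMap) := by
  have h : ∀ x : l₁, (U.toLieEquiv.toLinearEquiv.toLinearMap ∘ₗ τ ∘ₗ S.toLinearMap) x =
    U.toLieEquiv (τ (S x)) := fun _ => rfl
  have h' : ∀ (x y : A₂), U.toLieEquiv x - U.toLieEquiv y = U.toLieEquiv (x - y) := by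
    intros; simp
  have hl : ∀ x y : A₂, U.toLieEquiv ⁅x, y⁆ = ⁅U.toLieEquiv x, U.toLieEquiv y⁆ :=
    fun x y => U.toLieEquiv.toLieHom.map_lie x y
  ext L₁ L₂ L₃
  · have e : ∀ x y, ⁅U.toLieEquiv x, y⁆ = U.toLieEquiv ⁅x, U.toLieEquiv.symm y⁆ := by
      intros; rw [hl, LieEquiv.apply_symm_apply]
    simp only [pullback_γ, act_γ, LinearMap.add_apply, LinearMap.sub_apply, pullback_β,
      dualOfFrom_apply, h, pullback_ξ, e, U.map_form, LieEquiv.symm_apply_apply]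
  · simp only [pullback_ε, act_ε, LinearMap.add_apply, LinearMap.sub_apply, pullback_β,
      dualOfFrom_apply, h, pullback_ξ, pullback_α, pullback_γ, h', U.map_form,
      LieEquiv.symm_apply_apply, ← hl]
  · simp [pullback_ξ, act_ξ, h, hl]

lemma pullback_refl (c : QuadraticCochain l₁ A₁) :
    c.pullback (LinearEquiv.refl ℝ l₁) (Iso.refl A₁) = c := rfl

lemma pullback_pullback (S' : l₃ ≃ₗ[ℝ] l₁) (U' : Iso A₁ A₃) :
    (c.pullback S U).pullback S' U' = c.pullback (S'.trans S) (U.trans U') := rfl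

/-- The induced pull back of classes, `(S, U)^*[γ, ε, ξ] = [(S, U)^*(γ, ε, ξ)]`. -/
def pullbackClass (q : CochainClass l₂ A₂) : CochainClass l₁ A₁ :=
  Quotient.lift (fun c : QuadraticCochain l₂ A₂ => (c.pullback S U).cls) (by
    rintro c₁ c₂ ⟨τ, rfl⟩
    refine Quotient.sound ⟨U.toLieEquiv.toLinearEquiv.toLinearMap ∘ₗ τ ∘ₗ S.toLinearMap, ?_⟩
    exact (pullback_act S U c₂ τ).symm) q

end

end

section

variable (l : Type w) [AddCommGroup l] [Module ℝ l] (A : SymplecticLieAlgebra.{u})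

/-- Two classes in `H²(l, a, ω)_♯` lie in the same orbit of the group `G` of pairs `(S, U)` of an
automorphism `S` of the vector space `l` and an automorphism `U` of the symplectic Lie algebra
`(a, ω)`, which acts by pull back. -/
def orbitSetoid : Setoid (BalancedCohomology l A) where
  r q q' := ∃ (S : l ≃ₗ[ℝ] l) (U : Iso A A), pullbackClass S U q.1 = q'.1
  iseqv := by
    refine ⟨?_, ?_, ?_⟩
    · rintro ⟨q, hq⟩
      induction q using Quotient.inductionOn with
      | _ c => exact ⟨LinearEquiv.refl ℝ l, Iso.refl A, rfl⟩
    · rintro ⟨q, hq⟩ ⟨q', hq'⟩ ⟨S, U, h⟩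
      change pullbackClass S U q = q' at h
      subst h
      induction q using Quotient.inductionOn with
      | _ c =>
        refine ⟨S.symm, U.symm, ?_⟩
        change ((c.pullback S U).pullback S.symm U.symm).cls = c.cls
        congr 1
        ext <;> simp [pullback_γ, pullback_ε, pullback_ξ, Iso.symm]
    · rintro ⟨q, hq⟩ ⟨q', hq'⟩ ⟨q'', hq''⟩ ⟨S, U, h⟩ ⟨S', U', h'⟩
      change pullbackClass S U q = q' at h
      subst h
      change pullbackClass S' U' _ = q'' at h'
      subst h'
      induction q using Quotient.inductionOn with
      | _ c => exact ⟨S'.trans S, U.trans U', rfl⟩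

/-- The orbit space `H²(l, a, ω)_♯ / G`. -/
def OrbitSpace : Type (max u w) := Quotient (orbitSetoid l A)

variable {l A} in
/-- The `G`-orbit of the class `[γ, ε, ξ]` of a balanced quadratic cocycle. -/
def orbit (c : QuadraticCochain l A) (hc : c.IsBalancedCocycle) : OrbitSpace l A :=
  Quotient.mk (orbitSetoid l A) ⟨c.cls, c, hc, rfl⟩

end

/-! ### The standard model -/

section

variable {l : Type w} [AddCommGroup l] [Module ℝ l] {A : SymplecticLieAlgebra.{u}}

/-- The vector space `l^* ⊕ a ⊕ l`. -/
def StandardSpace (l : Type w) [AddCommGroup l] [Module ℝ l] (A : SymplecticLieAlgebra.{u}) :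
    Type (max u w) :=
  Module.Dual ℝ l × A × l

instance : AddCommGroup (StandardSpace l A) :=
  inferInstanceAs (AddCommGroup (Module.Dual ℝ l × A × l))

instance : Module ℝ (StandardSpace l A) :=
  inferInstanceAs (Module ℝ (Module.Dual ℝ l × A × l))

instance [FiniteDimensional ℝ l] : FiniteDimensional ℝ (StandardSpace l A) :=
  inferInstanceAs (FiniteDimensional ℝ (Module.Dual ℝ l × A × l))

/-- The bracket on `l^* ⊕ a ⊕ l`: `l^*` is central, `[a₁, a₂] = β(a₁, a₂) + [a₁, a₂]_a`,
`[L, a] = γ(L)a + ξ(L)a` and `[L₁, L₂] = ε(L₁, L₂) + α(L₁, L₂)`. -/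
def standardBracket (c : QuadraticCochain l A) (x y : StandardSpace l A) : StandardSpace l A :=
  (c.β x.2.1 y.2.1 + c.γ x.2.2 y.2.1 - c.γ y.2.2 x.2.1 + c.ε x.2.2 y.2.2,
    ⁅x.2.1, y.2.1⁆ + c.ξ x.2.2 y.2.1 - c.ξ y.2.2 x.2.1 + c.α x.2.2 y.2.2,
    0)

variable (l A) in
/-- The form `ω(Z₁ + a₁ + L₁, Z₂ + a₂ + L₂) = Z₁(L₂) + ω_a(a₁, a₂) - Z₂(L₁)`. -/
def standardForm : LinearMap.BilinForm ℝ (StandardSpace l A) :=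
  LinearMap.mk₂ ℝ (fun x y => x.1 y.2.2 + A.form x.2.1 y.2.1 - y.1 x.2.2)
    (by
      rintro ⟨z, a, L⟩ ⟨z', a', L'⟩ ⟨z'', a'', L''⟩
      change (z + z') L'' + A.form (a + a') a'' - z'' (L + L') = _
      simp; ring)
    (by
      rintro r ⟨z, a, L⟩ ⟨z'', a'', L''⟩
      change (r • z) L'' + A.form (r • a) a'' - z'' (r • L) = _
      simp; ring)
    (by
      rintro ⟨z'', a'', L''⟩ ⟨z, a, L⟩ ⟨z', a', L'⟩
      change z'' (L + L') + A.form a'' (a + a') - (z + z') L'' = _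
      simp; ring)
    (by
      rintro r ⟨z'', a'', L''⟩ ⟨z, a, L⟩
      change z'' (r • L) + A.form a'' (r • a) - (r • z) L'' = _
      simp; ring)

lemma standardForm_apply (x y : StandardSpace l A) :
    standardForm l A x y = x.1 y.2.2 + A.form x.2.1 y.2.1 - y.1 x.2.2 := rfl

lemma standardForm_nondegenerate : (standardForm l A).Nondegenerate := by
  constructor
  · rintro ⟨z, a, L⟩ h
    have h₁ : ∀ (z' : Module.Dual ℝ l) (a' : A) (L' : l), z L' + A.form a a' - z' L = 0 :=
      fun z' a' L' => h (z', a', L')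
    have hz : z = 0 := by ext L'; simpa using h₁ 0 0 L'
    have ha : a = 0 := A.nondegenerate.1 a fun a' => by simpa using h₁ 0 a' 0
    have hL : L = 0 := (Module.forall_dual_apply_eq_zero_iff ℝ L).1 fun z' => by
      simpa using h₁ z' 0 0
    subst hz ha hL
    rfl
  · rintro ⟨z, a, L⟩ h
    have h₁ : ∀ (z' : Module.Dual ℝ l) (a' : A) (L' : l), z' L + A.form a' a - z L' = 0 :=
      fun z' a' L' => h (z', a', L')
    have hz : z = 0 := by ext L'; simpa using h₁ 0 0 L'
    have ha : a = 0 := A.nondegenerate.2 a fun a' => by simpa using h₁ 0 a' 0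
    have hL : L = 0 := (Module.forall_dual_apply_eq_zero_iff ℝ L).1 fun z' => by
      simpa using h₁ z' 0 0
    subst hz ha hL
    rfl

lemma β_swap (c : QuadraticCochain l A) (a b : A) : c.β a b = -c.β b a := by
  ext L
  have e1 := form_swap (c.ξ L a) b
  have e2 := form_swap a (c.ξ L b)
  simp only [β_apply, LinearMap.neg_apply]
  linarith

lemma β_cyclic {c : QuadraticCochain l A} (hc : c.IsCocycle) (x y z : A) :
    c.β x ⁅y, z⁆ = c.β ⁅x, y⁆ z + c.β y ⁅x, z⁆ := by
  ext L
  have h1 := closed' (c.ξ L x) y z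
  have h2 := closed' x (c.ξ L y) z
  have h3 := closed' x y (c.ξ L z)
  rw [← lie_skew z (c.ξ L x)] at h1
  rw [← lie_skew z x] at h2
  rw [← lie_skew (c.ξ L z) x] at h3
  have e1 := form_swap (c.ξ L x) ⁅y, z⁆
  have e2 := form_swap x ⁅c.ξ L y, z⁆
  have e3 := form_swap x ⁅y, c.ξ L z⁆
  have e4 := form_swap (c.ξ L y) ⁅x, z⁆
  have e5 := form_swap y ⁅c.ξ L x, z⁆
  have e6 := form_swap y ⁅x, c.ξ L z⁆
  simp only [β_apply, LinearMap.add_apply, map_add, map_neg, LinearMap.neg_apply,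
    hc.derivation] at *
  linarith

@[ext]
lemma StandardSpace.ext' {x y : StandardSpace l A} (h₁ : x.1 = y.1) (h₂ : x.2.1 = y.2.1)
    (h₃ : x.2.2 = y.2.2) : x = y :=
  Prod.ext h₁ (Prod.ext h₂ h₃)

/-- The Lie ring structure on `l^* ⊕ a ⊕ l` given by a quadratic cocycle. -/
@[reducible]
def standardLieRing (c : QuadraticCochain l A) (hc : c.IsCocycle) :
    LieRing (StandardSpace l A) where
  bracket := c.standardBracket
  add_lie x y z := by
    apply StandardSpace.ext'
    · change c.β (x.2.1 + y.2.1) z.2.1 + c.γ (x.2.2 + y.2.2) z.2.1 - c.γ z.2.2 (x.2.1 + y.2.1) +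
        c.ε (x.2.2 + y.2.2) z.2.2 = (_ + _ - _ + _) + (_ + _ - _ + _)
      simp only [map_add, LinearMap.add_apply]; abel
    · change ⁅x.2.1 + y.2.1, z.2.1⁆ + c.ξ (x.2.2 + y.2.2) z.2.1 - c.ξ z.2.2 (x.2.1 + y.2.1) +
        c.α (x.2.2 + y.2.2) z.2.2 = (_ + _ - _ + _) + (_ + _ - _ + _)
      simp only [map_add, LinearMap.add_apply, add_lie, α_add_left]; abel
    · exact (add_zero (0 : l)).symm
  lie_add z x y := by
    apply StandardSpace.ext'
    · change c.β z.2.1 (x.2.1 + y.2.1) + c.γ z.2.2 (x.2.1 + y.2.1) - c.γ (x.2.2 + y.2.2) z.2.1 +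
        c.ε z.2.2 (x.2.2 + y.2.2) = (_ + _ - _ + _) + (_ + _ - _ + _)
      simp only [map_add, LinearMap.add_apply]; abel
    · change ⁅z.2.1, x.2.1 + y.2.1⁆ + c.ξ z.2.2 (x.2.1 + y.2.1) - c.ξ (x.2.2 + y.2.2) z.2.1 +
        c.α z.2.2 (x.2.2 + y.2.2) = (_ + _ - _ + _) + (_ + _ - _ + _)
      simp only [map_add, LinearMap.add_apply, lie_add, α_add_right]; abel
    · exact (add_zero (0 : l)).symm
  lie_self x := by
    apply StandardSpace.ext'
    · change c.β x.2.1 x.2.1 + c.γ x.2.2 x.2.1 - c.γ x.2.2 x.2.1 + c.ε x.2.2 x.2.2 = 0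
      have h : c.β x.2.1 x.2.1 = 0 := by
        ext t
        have := LinearMap.congr_fun (c.β_swap x.2.1 x.2.1) t
        simp only [LinearMap.neg_apply] at this
        simp only [LinearMap.zero_apply]
        linarith
      rw [h, c.ε_self]; abel
    · change ⁅x.2.1, x.2.1⁆ + c.ξ x.2.2 x.2.1 - c.ξ x.2.2 x.2.1 + c.α x.2.2 x.2.2 = 0
      simp
    · rfl
  leibniz_lie x y z := by
    obtain ⟨-, x, X⟩ := x
    obtain ⟨-, y, Y⟩ := y
    obtain ⟨-, z, Z⟩ := z
    apply StandardSpace.ext'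
    · change c.β x (⁅y, z⁆ + c.ξ Y z - c.ξ Z y + c.α Y Z) +
          c.γ X (⁅y, z⁆ + c.ξ Y z - c.ξ Z y + c.α Y Z) - c.γ 0 x + c.ε X 0 =
        (c.β (⁅x, y⁆ + c.ξ X y - c.ξ Y x + c.α X Y) z + c.γ 0 z -
          c.γ Z (⁅x, y⁆ + c.ξ X y - c.ξ Y x + c.α X Y) + c.ε 0 Z) +
        (c.β y (⁅x, z⁆ + c.ξ X z - c.ξ Z x + c.α X Z) +
          c.γ Y (⁅x, z⁆ + c.ξ X z - c.ξ Z x + c.α X Z) - c.γ 0 y + c.ε Y 0)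
      have h0 := β_cyclic hc x y z
      have h1 := hc.β_γ X y z
      have h2 := hc.β_γ Y x z
      have h3 := hc.β_γ Z x y
      have h4 := hc.dγ X Y z
      have h5 := hc.dγ Y Z x
      have h6 := hc.dγ X Z y
      have h7 := hc.γ_α X Y Z
      rw [c.β_swap (c.α Y Z)] at h5
      rw [c.β_swap (c.α X Z)] at h6
      rw [c.α_swap Z X] at h7
      rw [c.β_swap (c.ξ Y x)] at h2
      ext t
      replace h0 := LinearMap.congr_fun h0 t
      replace h1 := LinearMap.congr_fun h1 t
      replace h2 := LinearMap.congr_fun h2 t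
      replace h3 := LinearMap.congr_fun h3 t
      replace h4 := LinearMap.congr_fun h4 t
      replace h5 := LinearMap.congr_fun h5 t
      replace h6 := LinearMap.congr_fun h6 t
      replace h7 := LinearMap.congr_fun h7 t
      have s1 := LinearMap.congr_fun (c.β_swap z (c.ξ Y x)) t
      have s2 := LinearMap.congr_fun (c.β_swap (c.ξ Y x) z) t
      have s3 := LinearMap.congr_fun (c.β_swap (c.ξ Z x) y) t
      simp only [map_add, map_sub, map_neg, map_zero, LinearMap.add_apply, LinearMap.sub_apply,
        LinearMap.neg_apply, LinearMap.zero_apply] at *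
      linarith
    · change ⁅x, ⁅y, z⁆ + c.ξ Y z - c.ξ Z y + c.α Y Z⁆ +
          c.ξ X (⁅y, z⁆ + c.ξ Y z - c.ξ Z y + c.α Y Z) - c.ξ 0 x + c.α X 0 =
        (⁅⁅x, y⁆ + c.ξ X y - c.ξ Y x + c.α X Y, z⁆ + c.ξ 0 z -
          c.ξ Z (⁅x, y⁆ + c.ξ X y - c.ξ Y x + c.α X Y) + c.α 0 Z) +
        (⁅y, ⁅x, z⁆ + c.ξ X z - c.ξ Z x + c.α X Z⁆ +
          c.ξ Y (⁅x, z⁆ + c.ξ X z - c.ξ Z x + c.α X Z) - c.ξ 0 y + c.α Y 0)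
      have a0 : ∀ L, c.α L 0 = 0 := fun L => by simpa using c.α_smul_right 0 L 0
      have a1 : ∀ L, c.α 0 L = 0 := fun L => by simpa using c.α_smul_left 0 0 L
      have h1 := hc.curvature X Y z
      have h2 := hc.curvature X Z y
      have h3 := hc.curvature Y Z x
      have h4 := hc.bianchi X Y Z
      rw [← lie_skew] at h2 h3
      have k1 : c.ξ X (c.ξ Y z) = ⁅c.α X Y, z⁆ + c.ξ Y (c.ξ X z) := sub_eq_iff_eq_add.1 h1
      have k2 : c.ξ X (c.ξ Z y) = -⁅y, c.α X Z⁆ + c.ξ Z (c.ξ X y) := sub_eq_iff_eq_add.1 h2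
      have k3 : c.ξ Y (c.ξ Z x) = -⁅x, c.α Y Z⁆ + c.ξ Z (c.ξ Y x) := sub_eq_iff_eq_add.1 h3
      have k4 : c.ξ X (c.α Y Z) = c.ξ Y (c.α X Z) - c.ξ Z (c.α X Y) := by
        rw [← sub_eq_zero, ← h4]; abel
      simp only [map_add, map_sub, map_zero, LinearMap.zero_apply, lie_add, lie_sub, add_lie,
        sub_lie, a0, a1, hc.derivation, k1, k2, k3, k4, leibniz_lie x y z]
      rw [← lie_skew (c.ξ Z x) y]
      abel
    · exact (add_zero (0 : l)).symm

/-- The Lie algebra structure on `l^* ⊕ a ⊕ l` given by a quadratic cocycle. -/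
@[reducible]
def standardLieAlgebra (c : QuadraticCochain l A) (hc : c.IsCocycle) :
    letI := c.standardLieRing hc
    LieAlgebra ℝ (StandardSpace l A) :=
  letI := c.standardLieRing hc
  { toModule := inferInstanceAs (Module ℝ (StandardSpace l A))
    lie_smul := fun r x y => by
      apply StandardSpace.ext'
      · change c.β x.2.1 (r • y.2.1) + c.γ x.2.2 (r • y.2.1) - c.γ (r • y.2.2) x.2.1 +
          c.ε x.2.2 (r • y.2.2) = r • (_ + _ - _ + _)
        simp only [map_smul, LinearMap.smul_apply, smul_add, smul_sub]
      · change ⁅x.2.1, r • y.2.1⁆ + c.ξ x.2.2 (r • y.2.1) - c.ξ (r • y.2.2) x.2.1 +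
          c.α x.2.2 (r • y.2.2) = r • (_ + _ - _ + _)
        simp only [map_smul, LinearMap.smul_apply, smul_add, smul_sub, lie_smul, α_smul_right]
      · exact (smul_zero r).symm }

/-- The standard model: the symplectic Lie algebra `l^* ⊕ a ⊕ l` given by a quadratic cocycle. -/
def standardModel [FiniteDimensional ℝ l] (c : QuadraticCochain l A) (hc : c.IsCocycle) :
    SymplecticLieAlgebra.{max u w} where
  carrier := StandardSpace l A
  lieRing := c.standardLieRing hc
  lieAlgebra := c.standardLieAlgebra hc
  finiteDimensional := inferInstanceAs (FiniteDimensional ℝ (StandardSpace l A))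
  form := standardForm l A
  isAlt x := by
    change x.1 x.2.2 + A.form x.2.1 x.2.1 - x.1 x.2.2 = 0
    rw [A.isAlt]
    ring
  nondegenerate := standardForm_nondegenerate
  closed x y z := by
    obtain ⟨x', x, X⟩ := x
    obtain ⟨y', y, Y⟩ := y
    obtain ⟨z', z, Z⟩ := z
    change -(((c.β x y + c.γ X y - c.γ Y x + c.ε X Y) Z +
        A.form (⁅x, y⁆ + c.ξ X y - c.ξ Y x + c.α X Y) z) - z' 0) +
      (((c.β x z + c.γ X z - c.γ Z x + c.ε X Z) Y +
        A.form (⁅x, z⁆ + c.ξ X z - c.ξ Z x + c.α X Z) y) - y' 0) -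
      (((c.β y z + c.γ Y z - c.γ Z y + c.ε Y Z) X +
        A.form (⁅y, z⁆ + c.ξ Y z - c.ξ Z y + c.α Y Z) x) - x' 0) = 0
    have h0 := A.closed x y z
    have h1 := hc.ε_cyclic X Y Z
    have h2 := LinearMap.congr_fun (c.ε_swap Z X) Y
    have s1 := form_swap (c.ξ Z y) x
    have s2 := form_swap (c.ξ Y z) x
    have s3 := form_swap (c.ξ X z) y
    simp only [map_add, map_sub, map_zero, LinearMap.add_apply, LinearMap.sub_apply,
      LinearMap.neg_apply, form_α, β_apply] at *
    linarith

end

end QuadraticCochain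

end

open SymplecticLieAlgebra QuadraticCochain

/-! The argument has three parts: every model has the expected invariants, every symplectic Lie
algebra is a model, and two models are isomorphic exactly when their cocycles lie in one orbit.

Invariants. Condition (a) says that the center of the model has no component in `l`. The center is
then `l^*` plus the subspace of `a` in condition (b), and (b) says that the radical of `ω` on it is
just `l^*`. So balanced means `j = l^*` (`isBalancedCocycle_iff`). Then `j^⊥ = l^* ⊕ a`, and `j^⊥ /
j` is `a`.

Surjectivity. Given `g` with `j^⊥ / j ≅ a`, lift `a` linearly to `j^⊥` and choose an isotropic
complement of `j^⊥` that is dual to `j` and orthogonal to the lift (`exists_frame`). In this frame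
the bracket has the standard shape: `γ`, `ε`, `ξ` are read off, closedness of `ω` forces `β` and
`α`, and the cocycle conditions are the components of the Jacobi identity together with closedness
on `l` (`exists_standardModel_iso`).

Orbits. An isomorphism of models preserves `j` and `j^⊥`, hence is block triangular. Its diagonal
blocks give a pair in `G`. The unipotent rest is a shear along some `τ : l → a`, which realizes the
action of `C^1`, up to a map that changes no triple (`exists_pullback_eq_act`). Conversely, block
maps and shears are isomorphisms of models (`nonempty_iso_of_pullback_eq_act`).

For (ii), the center is degenerate iff `j ≠ 0`. Both `dim j` and the class of `j^⊥ / j` are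
isomorphism invariants, so the classes split according to them and (i) applies to each piece. -/

noncomputable section

/-! ### Shears and block maps: equivalent cocycles have isomorphic standard models. -/

namespace SymplecticLieAlgebra

/-- A linear equivalence that respects brackets and forms is an isomorphism of symplectic
Lie algebras. -/
def Iso.ofLinearEquiv {g : SymplecticLieAlgebra.{u}} {h : SymplecticLieAlgebra.{v}}
    (e : g ≃ₗ[ℝ] h) (hb : ∀ x y : g, e ⁅x, y⁆ = ⁅e x, e y⁆)
    (hf : ∀ x y : g, h.form (e x) (e y) = g.form x y) : Iso g h where
  toLieEquiv := { e with map_lie' := hb _ _ }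
  map_form := hf

end SymplecticLieAlgebra

namespace QuadraticCochain

variable {l : Type w} [AddCommGroup l] [Module ℝ l] {A : SymplecticLieAlgebra.{u}}

section StandardSpace

/-- The element `z + a + L` of `l^* ⊕ a ⊕ l`. -/
def StandardSpace.mk (z : Module.Dual ℝ l) (a : A) (L : l) : StandardSpace l A := (z, a, L)

@[simp] lemma StandardSpace.mk_fst (z : Module.Dual ℝ l) (a : A) (L : l) :
    (StandardSpace.mk z a L).1 = z := rfl

@[simp] lemma StandardSpace.mk_mid (z : Module.Dual ℝ l) (a : A) (L : l) :
    (StandardSpace.mk z a L).2.1 = a := rfl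

@[simp] lemma StandardSpace.mk_last (z : Module.Dual ℝ l) (a : A) (L : l) :
    (StandardSpace.mk z a L).2.2 = L := rfl

@[simp] lemma StandardSpace.neg_fst (x : StandardSpace l A) : (-x).1 = -x.1 := rfl

@[simp] lemma StandardSpace.neg_mid (x : StandardSpace l A) : (-x).2.1 = -x.2.1 := rfl

@[simp] lemma StandardSpace.neg_last (x : StandardSpace l A) : (-x).2.2 = -x.2.2 := rfl

@[simp] lemma StandardSpace.add_fst (x y : StandardSpace l A) : (x + y).1 = x.1 + y.1 := rfl

@[simp] lemma StandardSpace.add_mid (x y : StandardSpace l A) :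
    (x + y).2.1 = x.2.1 + y.2.1 := rfl

@[simp] lemma StandardSpace.add_last (x y : StandardSpace l A) :
    (x + y).2.2 = x.2.2 + y.2.2 := rfl

@[simp] lemma StandardSpace.smul_fst (r : ℝ) (x : StandardSpace l A) :
    (r • x).1 = r • x.1 := rfl

@[simp] lemma StandardSpace.smul_mid (r : ℝ) (x : StandardSpace l A) :
    (r • x).2.1 = r • x.2.1 := rfl

@[simp] lemma StandardSpace.smul_last (r : ℝ) (x : StandardSpace l A) :
    (r • x).2.2 = r • x.2.2 := rfl

end StandardSpace

@[simp]
lemma α_zero_left (c : QuadraticCochain l A) (L : l) : c.α 0 L = 0 := by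
  simpa using c.α_smul_left 0 0 L

@[simp]
lemma α_zero_right (c : QuadraticCochain l A) (L : l) : c.α L 0 = 0 := by
  simpa using c.α_smul_right 0 L 0

lemma standardBracket_fst (c : QuadraticCochain l A) (x y : StandardSpace l A) :
    (c.standardBracket x y).1 =
      c.β x.2.1 y.2.1 + c.γ x.2.2 y.2.1 - c.γ y.2.2 x.2.1 + c.ε x.2.2 y.2.2 := rfl

lemma standardBracket_mid (c : QuadraticCochain l A) (x y : StandardSpace l A) :
    (c.standardBracket x y).2.1 =
      ⁅x.2.1, y.2.1⁆ + c.ξ x.2.2 y.2.1 - c.ξ y.2.2 x.2.1 + c.α x.2.2 y.2.2 := rfl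

lemma standardBracket_last (c : QuadraticCochain l A) (x y : StandardSpace l A) :
    (c.standardBracket x y).2.2 = 0 := rfl

/-- The unipotent linear symplectic automorphism of `l^* ⊕ a ⊕ l` that sends `L` to
`L + τ L` modulo `l^*`. -/
def shear (τ : l →ₗ[ℝ] A) : StandardSpace l A ≃ₗ[ℝ] StandardSpace l A where
  -- The factor `1/2` makes the map symplectic: the two terms `τ^* τ L` contribute `-ω(τ L₁, τ L₂)`
  -- in total, which cancels the same term coming from the `a`-components.
  toFun x := .mk (x.1 + A.dualOfFrom τ x.2.1 + (1 / 2 : ℝ) • A.dualOfFrom τ (τ x.2.2))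
    (x.2.1 + τ x.2.2) x.2.2
  invFun x := .mk (x.1 - A.dualOfFrom τ (x.2.1 - τ x.2.2) -
    (1 / 2 : ℝ) • A.dualOfFrom τ (τ x.2.2)) (x.2.1 - τ x.2.2) x.2.2
  map_add' x y := by
    apply StandardSpace.ext'
    · simp only [StandardSpace.mk_fst, StandardSpace.add_fst, StandardSpace.add_mid,
        StandardSpace.add_last, map_add, smul_add]
      abel
    · simp only [StandardSpace.mk_mid, StandardSpace.add_mid, StandardSpace.add_last, map_add]
      abel
    · rfl
  map_smul' r x := by
    apply StandardSpace.ext'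
    · simp only [StandardSpace.mk_fst, StandardSpace.smul_fst, StandardSpace.smul_mid,
        StandardSpace.smul_last, map_smul, smul_add, smul_comm r (1 / 2 : ℝ), RingHom.id_apply]
    · simp only [StandardSpace.mk_mid, StandardSpace.smul_mid, StandardSpace.smul_last, map_smul,
        smul_add, RingHom.id_apply]
    · rfl
  left_inv x := by
    apply StandardSpace.ext'
    · simp only [StandardSpace.mk_fst, StandardSpace.mk_mid, StandardSpace.mk_last,
        add_sub_cancel_right]
      abel
    · simp
    · rfl
  right_inv x := by
    apply StandardSpace.ext'
    · simp only [StandardSpace.mk_fst, StandardSpace.mk_mid, StandardSpace.mk_last]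
      abel
    · simp
    · rfl

lemma shear_apply (τ : l →ₗ[ℝ] A) (x : StandardSpace l A) :
    shear τ x = .mk (x.1 + A.dualOfFrom τ x.2.1 + (1 / 2 : ℝ) • A.dualOfFrom τ (τ x.2.2))
      (x.2.1 + τ x.2.2) x.2.2 := rfl

lemma standardForm_shear (τ : l →ₗ[ℝ] A) (x y : StandardSpace l A) :
    standardForm l A (shear τ x) (shear τ y) = standardForm l A x y := by
  have e1 := form_swap (τ y.2.2) x.2.1
  have e2 := form_swap (τ y.2.2) (τ x.2.2)
  simp only [standardForm_apply, shear_apply, StandardSpace.mk_fst, StandardSpace.mk_mid,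
    StandardSpace.mk_last, LinearMap.add_apply, LinearMap.smul_apply, dualOfFrom_apply, map_add,
    smul_eq_mul] at *
  linarith

/-- The action formulas express the bracket in sheared coordinates. The sign is `-τ` because `L + τ
L` acts on `a` by `ξ L + ad (τ L)`, while `act` subtracts `ad (τ L)`. -/
lemma shear_standardBracket (c : QuadraticCochain l A) (τ : l →ₗ[ℝ] A)
    (x y : StandardSpace l A) :
    shear τ ((c.act (-τ)).standardBracket x y) =
      c.standardBracket (shear τ x) (shear τ y) := by
  have h := c.β_swap (τ y.2.2) x.2.1
  have h' := lie_skew x.2.1 (τ y.2.2)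
  apply StandardSpace.ext'
  · ext N
    simp only [shear_apply, StandardSpace.mk_fst, StandardSpace.mk_mid, StandardSpace.mk_last,
      standardBracket_fst, standardBracket_mid, standardBracket_last,
      act_γ, act_ε, act_ξ, act_α, act_β, LinearMap.add_apply, LinearMap.sub_apply,
      LinearMap.smul_apply, dualOfFrom_apply, LinearMap.neg_apply, map_neg, map_add, map_sub,
      smul_eq_mul, neg_lie, lie_neg, map_zero, LinearMap.zero_apply, h]
    ring
  · simp only [shear_apply, StandardSpace.mk_mid, StandardSpace.mk_last, standardBracket_mid,
      standardBracket_last, act_ξ, act_α, map_neg, LinearMap.neg_apply, neg_lie, lie_neg, map_zero,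
      lie_add, add_lie, map_add, ← h']
    abel
  · rfl

section

variable {l' : Type*} [AddCommGroup l'] [Module ℝ l'] {B : SymplecticLieAlgebra.{u}}

/-- The linear isomorphism `l^* ⊕ a ⊕ l → l'^* ⊕ b ⊕ l'` induced by `S : l → l'` and
`U : b → a`. -/
def blockEquiv (S : l ≃ₗ[ℝ] l') (U : Iso B A) : StandardSpace l A ≃ₗ[ℝ] StandardSpace l' B :=
  LinearEquiv.prodCongr S.symm.dualMap
    (LinearEquiv.prodCongr U.toLieEquiv.symm.toLinearEquiv S)

lemma blockEquiv_apply (S : l ≃ₗ[ℝ] l') (U : Iso B A) (x : StandardSpace l A) :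
    blockEquiv S U x =
      .mk (x.1 ∘ₗ S.symm.toLinearMap) (U.toLieEquiv.symm x.2.1) (S x.2.2) := rfl

lemma standardForm_blockEquiv (S : l ≃ₗ[ℝ] l') (U : Iso B A) (x y : StandardSpace l A) :
    standardForm l' B (blockEquiv S U x) (blockEquiv S U y) = standardForm l A x y := by
  simp [standardForm_apply, blockEquiv_apply, U.form_symm_left]

lemma blockEquiv_standardBracket (c : QuadraticCochain l' B) (S : l ≃ₗ[ℝ] l') (U : Iso B A)
    (x y : StandardSpace l A) :
    blockEquiv S U ((c.pullback S U).standardBracket x y) =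
      c.standardBracket (blockEquiv S U x) (blockEquiv S U y) := by
  have hl : ∀ a b : A, U.toLieEquiv.symm ⁅a, b⁆ = ⁅U.toLieEquiv.symm a, U.toLieEquiv.symm b⁆ :=
    fun a b => U.toLieEquiv.symm.toLieHom.map_lie a b
  apply StandardSpace.ext'
  · ext N
    simp only [blockEquiv_apply, StandardSpace.mk_fst, StandardSpace.mk_mid,
      StandardSpace.mk_last, standardBracket_fst, LinearMap.add_apply, LinearMap.sub_apply,
      LinearMap.comp_apply, pullback_β, pullback_γ, pullback_ε, LinearEquiv.coe_coe,
      LinearEquiv.apply_symm_apply]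
  · simp only [blockEquiv_apply, StandardSpace.mk_mid,
      StandardSpace.mk_last, standardBracket_mid, pullback_ξ, pullback_α, map_add, map_sub,
      hl, LieEquiv.symm_apply_apply]
  · simp only [blockEquiv_apply, StandardSpace.mk_last, standardBracket_last, map_zero]

end

lemma orbit_eq_of_pullback_eq_act {c c' : QuadraticCochain l A} (hc : c.IsBalancedCocycle)
    (hc' : c'.IsBalancedCocycle) (S : l ≃ₗ[ℝ] l) (U : Iso A A) (τ : l →ₗ[ℝ] A)
    (h : c = (c'.pullback S U).act τ) : orbit c hc = orbit c' hc' := by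
  refine (Quotient.sound ⟨S, U, ?_⟩ : orbit c' hc' = orbit c hc).symm
  change (c'.pullback S U).cls = c.cls
  exact (Quotient.sound ⟨τ, h.symm⟩ : c.cls = _).symm

variable [FiniteDimensional ℝ l]

/-- A linear isomorphism of standard spaces that is compatible with the brackets and the forms
is an isomorphism of the standard models. -/
def standardModelIso {c c' : QuadraticCochain l A} (hc : c.IsCocycle) (hc' : c'.IsCocycle)
    (e : StandardSpace l A ≃ₗ[ℝ] StandardSpace l A)
    (hb : ∀ x y, e (c.standardBracket x y) = c'.standardBracket (e x) (e y))
    (hf : ∀ x y, standardForm l A (e x) (e y) = standardForm l A x y) :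
    Iso (c.standardModel hc) (c'.standardModel hc') :=
  Iso.ofLinearEquiv (g := c.standardModel hc) (h := c'.standardModel hc') e hb hf

lemma nonempty_iso_of_pullback_eq_act {c c' : QuadraticCochain l A} (hc : c.IsCocycle)
    (hc' : c'.IsCocycle) (S : l ≃ₗ[ℝ] l) (U : Iso A A) (τ : l →ₗ[ℝ] A)
    (h : c.act τ = c'.pullback S U) :
    Nonempty (Iso (c.standardModel hc) (c'.standardModel hc')) := by
  -- The map is built backwards: the inverse block map carries `c'` to its pullback, which is `c.act
  -- τ`, and the shear along `-τ` carries that to `c`.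
  refine ⟨Iso.symm (standardModelIso hc' hc ((blockEquiv S U).symm.trans (shear (-τ))) ?_ ?_)⟩
  · intro x y
    obtain ⟨x, rfl⟩ := (blockEquiv S U).surjective x
    obtain ⟨y, rfl⟩ := (blockEquiv S U).surjective y
    rw [← blockEquiv_standardBracket]
    simp only [LinearEquiv.trans_apply, LinearEquiv.symm_apply_apply]
    rw [← h, ← shear_standardBracket, neg_neg]
  · intro x y
    obtain ⟨x, rfl⟩ := (blockEquiv S U).surjective x
    obtain ⟨y, rfl⟩ := (blockEquiv S U).surjective y
    simp only [LinearEquiv.trans_apply, LinearEquiv.symm_apply_apply]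
    rw [standardForm_shear, standardForm_blockEquiv]

lemma nonempty_iso_of_orbit_eq {c c' : QuadraticCochain l A} (hc : c.IsBalancedCocycle)
    (hc' : c'.IsBalancedCocycle) (h : orbit c hc = orbit c' hc') :
    Nonempty (Iso (c.standardModel hc.toIsCocycle) (c'.standardModel hc'.toIsCocycle)) := by
  obtain ⟨S, U, h⟩ := Quotient.exact h
  change (c.pullback S U).cls = c'.cls at h
  obtain ⟨τ, h⟩ := Quotient.exact h
  obtain ⟨e⟩ := nonempty_iso_of_pullback_eq_act hc'.toIsCocycle hc.toIsCocycle S U τ h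
  exact ⟨e.symm⟩

end QuadraticCochain

end
-- The canonical ideal and the reduction as isomorphism invariants.
noncomputable section

namespace SymplecticLieAlgebra

/-- `Nondegenerate` asks for separation on both sides; the restricted form is reflexive, so one side
is enough. -/
lemma nondegenerateOn_iff (A : SymplecticLieAlgebra.{u}) (W : Submodule ℝ A) :
    A.NondegenerateOn W ↔ ∀ w ∈ W, (∀ v ∈ W, A.form v w = 0) → w = 0 := by
  have hr : (A.form.restrict W).IsRefl := by
    intro x y h
    change A.form y.1 x.1 = 0
    rw [form_swap]
    exact neg_eq_zero.2 h
  refine (LinearMap.IsRefl.nondegenerate_iff_separatingRight hr).trans ?_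
  constructor
  · intro h w hw hv
    exact congrArg Subtype.val (h ⟨w, hw⟩ fun v => hv v.1 v.2)
  · intro h w hv
    exact Subtype.ext (h w.1 w.2 fun v hv' => hv ⟨v, hv'⟩)

variable {g : SymplecticLieAlgebra.{u}} {h : SymplecticLieAlgebra.{v}}

lemma mem_center_iff (x : g) : x ∈ LieAlgebra.center ℝ g ↔ ∀ y : g, ⁅x, y⁆ = 0 := by
  refine ⟨fun hx y => ?_, fun hx y => ?_⟩
  · rw [← lie_skew, hx y, neg_zero]
  · rw [← lie_skew, hx y, neg_zero]

lemma mem_canonicalIdeal_iff (x : g) : x ∈ g.canonicalIdeal ↔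
    x ∈ LieAlgebra.center ℝ g ∧ ∀ z ∈ LieAlgebra.center ℝ g, g.form z x = 0 := Iff.rfl

lemma mem_canonicalPerp_iff (x : g) :
    x ∈ g.canonicalPerp ↔ ∀ z ∈ g.canonicalIdeal, g.form z x = 0 := Iff.rfl

lemma canonicalIdeal_le_canonicalPerp : g.canonicalIdeal ≤ g.canonicalPerp :=
  fun _ hx z hz => hx.2 z hz.1

/-- By definition `j` is the radical of `ω` restricted to the center. -/
lemma hasDegenerateCenter_iff : g.HasDegenerateCenter ↔ Module.finrank ℝ g.canonicalIdeal ≠ 0 := by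
  have : Module.finrank ℝ g.canonicalIdeal = 0 ↔ ∀ x ∈ g.canonicalIdeal, x = 0 := by
    rw [show Module.finrank ℝ g.canonicalIdeal =
      Module.finrank ℝ g.canonicalIdeal.toSubmodule from rfl, Submodule.finrank_eq_zero,
      Submodule.eq_bot_iff]
    rfl
  rw [HasDegenerateCenter, Ne, this, nondegenerateOn_iff]
  simp only [mem_canonicalIdeal_iff, and_imp]
  rfl

lemma finrank_canonicalPerp (g : SymplecticLieAlgebra.{u}) :
    Module.finrank ℝ g.canonicalIdeal + Module.finrank ℝ g.canonicalPerp = Module.finrank ℝ g := by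
  have h1 := LinearMap.BilinForm.finrank_orthogonal g.nondegenerate g.canonicalIdeal.toSubmodule
  have h2 := Submodule.finrank_le g.canonicalIdeal.toSubmodule
  change Module.finrank ℝ g.canonicalPerp.toSubmodule = _ at h1
  change Module.finrank ℝ g.canonicalIdeal.toSubmodule +
    Module.finrank ℝ g.canonicalPerp.toSubmodule = _
  omega

/-- Since `ω` is non-degenerate, `j^⊥` has codimension `dim j`, and passing to the quotient by `j ⊆
j^⊥` removes the same dimension again. -/
lemma finrank_reduction (g : SymplecticLieAlgebra.{u}) :
    Module.finrank ℝ g.reduction + 2 * Module.finrank ℝ g.canonicalIdeal =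
      Module.finrank ℝ g := by
  have h1 := finrank_canonicalPerp g
  have h2 := Submodule.finrank_quotient_add_finrank g.canonicalIdealInPerp.toSubmodule
  have h3 : Module.finrank ℝ g.canonicalIdealInPerp.toSubmodule =
      Module.finrank ℝ g.canonicalIdeal :=
    (Submodule.comapSubtypeEquivOfLe
      (p := g.canonicalIdeal.toSubmodule) (q := g.canonicalPerp.toSubmodule)
      canonicalIdeal_le_canonicalPerp).finrank_eq
  rw [h3] at h2
  change Module.finrank ℝ g.reduction + _ = Module.finrank ℝ g.canonicalPerp at h2
  omega

/-- A surjective homomorphism from `j^⊥` that preserves the forms induces an isomorphism from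
`j^⊥ / j`. -/
lemma nonempty_iso_reduction (p : g.canonicalPerp →ₗ[ℝ] h)
    (hp : Function.Surjective p) (hl : ∀ x y, p ⁅x, y⁆ = ⁅p x, p y⁆)
    (hf : ∀ x y, h.form (p x) (p y) = g.form x.1 y.1) : Nonempty (Iso g.reduction h) := by
  -- The form alone controls the kernel. The image of `j` is orthogonal to the image of `p`, which
  -- is everything, so it vanishes; the form on `j^⊥ / j` is non-degenerate, so nothing more is
  -- killed.
  have hj : g.canonicalIdealInPerp.toSubmodule ≤ LinearMap.ker p := by
    intro x hx
    refine h.nondegenerate.1 _ fun y => ?_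
    obtain ⟨y, rfl⟩ := hp y
    rw [hf]
    exact y.2 _ hx
  let q : g.reduction →ₗ[ℝ] h := Submodule.liftQ g.canonicalIdealInPerp.toSubmodule p hj
  have hqf : ∀ x y, h.form (q x) (q y) = g.reduction.form x y := by
    intro x y
    obtain ⟨x, rfl⟩ := Submodule.Quotient.mk_surjective _ x
    obtain ⟨y, rfl⟩ := Submodule.Quotient.mk_surjective _ y
    exact hf x y
  have hq : Function.Bijective q := by
    constructor
    · refine (injective_iff_map_eq_zero q).2 fun x hx => g.reduction.nondegenerate.1 x fun y => ?_
      rw [← hqf, hx, map_zero, LinearMap.zero_apply]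
    · intro y
      obtain ⟨x, rfl⟩ := hp y
      exact ⟨Submodule.Quotient.mk x, rfl⟩
  refine ⟨Iso.ofLinearEquiv (LinearEquiv.ofBijective q hq) (fun x y => ?_) hqf⟩
  obtain ⟨x, rfl⟩ := Submodule.Quotient.mk_surjective _ x
  obtain ⟨y, rfl⟩ := Submodule.Quotient.mk_surjective _ y
  exact hl x y

namespace Iso

lemma map_lie (e : Iso g h) (x y : g) : e.toLieEquiv ⁅x, y⁆ = ⁅e.toLieEquiv x, e.toLieEquiv y⁆ :=
  e.toLieEquiv.toLieHom.map_lie x y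

lemma surjective (e : Iso g h) : Function.Surjective e.toLieEquiv := e.toLieEquiv.surjective

lemma mem_center_iff (e : Iso g h) (x : g) :
    e.toLieEquiv x ∈ LieAlgebra.center ℝ h ↔ x ∈ LieAlgebra.center ℝ g := by
  rw [SymplecticLieAlgebra.mem_center_iff, SymplecticLieAlgebra.mem_center_iff,
    e.surjective.forall]
  refine forall_congr' fun y => ?_
  rw [← e.map_lie]
  exact map_eq_zero_iff e.toLieEquiv.toLinearEquiv e.toLieEquiv.injective

lemma mem_canonicalIdeal_iff (e : Iso g h) (x : g) :
    e.toLieEquiv x ∈ h.canonicalIdeal ↔ x ∈ g.canonicalIdeal := by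
  rw [SymplecticLieAlgebra.mem_canonicalIdeal_iff, SymplecticLieAlgebra.mem_canonicalIdeal_iff,
    e.surjective.forall]
  simp only [e.mem_center_iff, e.map_form]

lemma mem_canonicalPerp_iff (e : Iso g h) (x : g) :
    e.toLieEquiv x ∈ h.canonicalPerp ↔ x ∈ g.canonicalPerp := by
  rw [SymplecticLieAlgebra.mem_canonicalPerp_iff, SymplecticLieAlgebra.mem_canonicalPerp_iff,
    e.surjective.forall]
  simp only [e.mem_canonicalIdeal_iff, e.map_form]

lemma finrank_eq (e : Iso g h) : Module.finrank ℝ g = Module.finrank ℝ h :=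
  e.toLieEquiv.toLinearEquiv.finrank_eq

lemma finrank_canonicalIdeal_eq (e : Iso g h) :
    Module.finrank ℝ g.canonicalIdeal = Module.finrank ℝ h.canonicalIdeal := by
  have hm : g.canonicalIdeal.toSubmodule.map e.toLieEquiv.toLinearEquiv.toLinearMap =
      h.canonicalIdeal.toSubmodule := by
    ext y
    obtain ⟨y, rfl⟩ := e.surjective y
    refine ⟨?_, fun hy => ⟨y, (e.mem_canonicalIdeal_iff y).1 hy, rfl⟩⟩
    rintro ⟨x, hx, hxy⟩
    rw [← hxy]
    exact (e.mem_canonicalIdeal_iff x).2 hx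
  exact (LinearEquiv.finrank_map_eq e.toLieEquiv.toLinearEquiv
    g.canonicalIdeal.toSubmodule).symm.trans (by rw [hm]; rfl)

lemma nonempty_reduction (e : Iso g h) : Nonempty (Iso g.reduction h.reduction) := by
  let p : g.canonicalPerp →ₗ[ℝ] h.reduction :=
    (Submodule.mkQ h.canonicalIdealInPerp.toSubmodule).comp
      (LinearMap.restrict (p := g.canonicalPerp.toSubmodule) (q := h.canonicalPerp.toSubmodule)
        e.toLieEquiv.toLinearEquiv.toLinearMap fun x hx => (e.mem_canonicalPerp_iff x).2 hx)
  refine nonempty_iso_reduction p ?_ ?_ ?_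
  · intro y
    obtain ⟨⟨y, hy⟩, rfl⟩ := Submodule.Quotient.mk_surjective _ y
    obtain ⟨y, rfl⟩ := e.surjective y
    exact ⟨⟨y, (e.mem_canonicalPerp_iff y).1 hy⟩, rfl⟩
  · intro x y
    refine congrArg (Submodule.Quotient.mk (p := h.canonicalIdealInPerp.toSubmodule))
      (Subtype.ext ?_)
    exact e.map_lie x.1 y.1
  · intro x y
    exact e.map_form x.1 y.1

end Iso

end SymplecticLieAlgebra

/-! ### Balanced cocycles and the canonical ideal of the standard model. -/

namespace QuadraticCochain

variable {l : Type w} [AddCommGroup l] [Module ℝ l] {A : SymplecticLieAlgebra.{u}}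
  {c : QuadraticCochain l A}

lemma mem_balancedSubspace_iff (a : A) : a ∈ c.balancedSubspace ↔
    (∀ b : A, ⁅a, b⁆ = 0) ∧ (∀ b : A, c.β a b = 0) ∧ (∀ L : l, c.ξ L a = 0) ∧
      ∀ L : l, c.γ L a = 0 := by
  simp only [balancedSubspace, Submodule.mem_inf, LinearMap.mem_ker, LinearMap.ext_iff,
    LinearMap.flip_apply, LinearMap.zero_apply, and_assoc]
  exact and_congr_left' (mem_center_iff a)

variable [FiniteDimensional ℝ l]

/-- These are the four equations of `condA`, obtained by bracketing with `a` and with `l` and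
separating the `l^*`- and `a`-components. The `l^*`-part of `x` does not matter. -/
lemma mem_center_standardModel_iff (hc : c.IsCocycle) (x : c.standardModel hc) :
    x ∈ LieAlgebra.center ℝ (c.standardModel hc) ↔
      (∀ b : A, ⁅x.2.1, b⁆ + c.ξ x.2.2 b = 0) ∧ (∀ b : A, c.γ x.2.2 b + c.β x.2.1 b = 0) ∧
      (∀ L : l, c.α x.2.2 L = c.ξ L x.2.1) ∧ ∀ L : l, c.ε x.2.2 L = c.γ L x.2.1 := by
  rw [mem_center_iff]
  constructor
  · intro h
    have h1 : ∀ b : A, c.standardBracket x (.mk 0 b 0) = 0 := fun b => h (.mk 0 b 0)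
    have h2 : ∀ L : l, c.standardBracket x (.mk 0 0 L) = 0 := fun L => h (.mk 0 0 L)
    refine ⟨fun b => ?_, fun b => ?_, fun L => ?_, fun L => ?_⟩
    · have : ⁅x.2.1, b⁆ + c.ξ x.2.2 b - c.ξ 0 x.2.1 + c.α x.2.2 0 = 0 :=
        congrArg (fun y : StandardSpace l A => y.2.1) (h1 b)
      simpa using this
    · have : c.β x.2.1 b + c.γ x.2.2 b - c.γ 0 x.2.1 + c.ε x.2.2 0 = 0 :=
        congrArg (fun y : StandardSpace l A => y.1) (h1 b)
      rw [add_comm]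
      simpa using this
    · have : ⁅x.2.1, (0 : A)⁆ + c.ξ x.2.2 0 - c.ξ L x.2.1 + c.α x.2.2 L = 0 :=
        congrArg (fun y : StandardSpace l A => y.2.1) (h2 L)
      rw [← sub_eq_zero, ← neg_add_eq_sub]
      simpa using this
    · have : c.β x.2.1 0 + c.γ x.2.2 0 - c.γ L x.2.1 + c.ε x.2.2 L = 0 :=
        congrArg (fun y : StandardSpace l A => y.1) (h2 L)
      rw [← sub_eq_zero, ← neg_add_eq_sub]
      simpa using this
  · rintro ⟨h1, h2, h3, h4⟩ y
    apply StandardSpace.ext'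
    · change c.β x.2.1 y.2.1 + c.γ x.2.2 y.2.1 - c.γ y.2.2 x.2.1 + c.ε x.2.2 y.2.2 = 0
      rw [h4, add_comm (c.β _ _), h2]
      abel
    · change ⁅x.2.1, y.2.1⁆ + c.ξ x.2.2 y.2.1 - c.ξ y.2.2 x.2.1 + c.α x.2.2 y.2.2 = 0
      rw [h3, h1]
      abel
    · rfl

lemma mk_mem_center_standardModel_iff (hc : c.IsCocycle) (z : Module.Dual ℝ l) (a : A) :
    (StandardSpace.mk z a 0 : c.standardModel hc) ∈ LieAlgebra.center ℝ (c.standardModel hc) ↔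
      a ∈ c.balancedSubspace := by
  refine (mem_center_standardModel_iff hc _).trans ?_
  rw [mem_balancedSubspace_iff]
  simp [eq_comm]

/-- A cocycle is balanced if and only if the canonical ideal of its standard model is `l^*`. -/
lemma isBalancedCocycle_iff (hc : c.IsCocycle) : c.IsBalancedCocycle ↔
    ∀ x : c.standardModel hc, x ∈ (c.standardModel hc).canonicalIdeal ↔
      x.2.1 = 0 ∧ x.2.2 = 0 := by
  constructor
  · intro hb
    -- `condA` confines the center to `l^* ⊕ a`. Its `a`-part is then `balancedSubspace`, on which
    -- `condB` gives non-degeneracy.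
    have hz : ∀ x : c.standardModel hc, x ∈ LieAlgebra.center ℝ (c.standardModel hc) →
        x.2.2 = 0 := by
      intro x hx
      obtain ⟨h1, h2, h3, h4⟩ := (mem_center_standardModel_iff hc x).1 hx
      exact hb.condA _ _ h1 h2 h3 h4
    rintro ⟨z, a, L⟩
    constructor
    · rintro ⟨hx, hx'⟩
      obtain rfl : L = 0 := hz _ hx
      refine ⟨?_, rfl⟩
      refine (nondegenerateOn_iff A _).1 hb.condB a
        ((mk_mem_center_standardModel_iff hc z a).1 hx) fun b hbm => ?_
      have : (0 : Module.Dual ℝ l) 0 + A.form b a - z 0 = 0 :=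
        hx' _ ((mk_mem_center_standardModel_iff hc 0 b).2 hbm)
      simpa using this
    · rintro ⟨h1, h2⟩
      obtain rfl : a = 0 := h1
      obtain rfl : L = 0 := h2
      refine ⟨(mk_mem_center_standardModel_iff hc z 0).2 (Submodule.zero_mem _), fun y hy => ?_⟩
      change y.1 0 + A.form y.2.1 0 - z y.2.2 = 0
      rw [hz y hy]
      simp
  · intro h
    -- By assumption `l^*` lies in `j`, so it is orthogonal to the center; as `l^*` separates points
    -- of `l`, central elements have no `l`-component.
    have hA : ∀ x : c.standardModel hc, x ∈ LieAlgebra.center ℝ (c.standardModel hc) →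
        x.2.2 = 0 := by
      intro x hx
      refine (Module.forall_dual_apply_eq_zero_iff ℝ x.2.2).1 fun z => ?_
      have : x.1 0 + A.form x.2.1 0 - z x.2.2 = 0 := ((h (.mk z 0 0)).2 ⟨rfl, rfl⟩).2 x hx
      simpa using this
    refine ⟨hc, fun L a h1 h2 h3 h4 => ?_, ?_⟩
    · exact hA (.mk 0 a L) ((mem_center_standardModel_iff hc _).2 ⟨h1, h2, h3, h4⟩)
    · refine (nondegenerateOn_iff A _).2 fun a ha hv => ?_
      refine ((h (.mk 0 a 0)).1 ⟨(mk_mem_center_standardModel_iff hc 0 a).2 ha, ?_⟩).1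
      rintro ⟨z, b, L⟩ hy
      obtain rfl : L = 0 := hA _ hy
      change z 0 + A.form b a - (0 : Module.Dual ℝ l) 0 = 0
      simpa using hv b ((mk_mem_center_standardModel_iff hc z b).1 hy)

/-- Here `j = l^*`, and `l^*` pairs perfectly with `l` and trivially with `l^* ⊕ a`. -/
lemma mem_canonicalPerp_standardModel_iff (hc : c.IsBalancedCocycle)
    (x : c.standardModel hc.toIsCocycle) :
    x ∈ (c.standardModel hc.toIsCocycle).canonicalPerp ↔ x.2.2 = 0 := by
  have hj := (isBalancedCocycle_iff hc.toIsCocycle).1 hc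
  rw [mem_canonicalPerp_iff]
  constructor
  · intro h
    refine (Module.forall_dual_apply_eq_zero_iff ℝ x.2.2).1 fun z => ?_
    have : z x.2.2 + A.form 0 x.2.1 - x.1 0 = 0 := h (.mk z 0 0) ((hj _).2 ⟨rfl, rfl⟩)
    simpa using this
  · intro h y hy
    obtain ⟨h1, h2⟩ := (hj y).1 hy
    change y.1 x.2.2 + A.form y.2.1 x.2.1 - x.1 y.2.2 = 0
    rw [h, h1, h2]
    simp

lemma finrank_standardSpace :
    Module.finrank ℝ (StandardSpace l A) = 2 * Module.finrank ℝ l + Module.finrank ℝ A := by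
  change Module.finrank ℝ (Module.Dual ℝ l × A × l) = _
  rw [Module.finrank_prod, Module.finrank_prod, Subspace.dual_finrank_eq]
  ring

/-- The projection `l^* ⊕ a → a` is a homomorphism because `β` only contributes to `l^*`, and it
preserves the forms. -/
lemma nonempty_reduction_standardModel (hc : c.IsBalancedCocycle) :
    Nonempty (Iso (c.standardModel hc.toIsCocycle).reduction A) := by
  have hP := mem_canonicalPerp_standardModel_iff hc
  let p : (c.standardModel hc.toIsCocycle).canonicalPerp →ₗ[ℝ] A :=
    { toFun := fun x => x.1.2.1
      map_add' := fun _ _ => rfl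
      map_smul' := fun _ _ => rfl }
  refine nonempty_iso_reduction p ?_ ?_ ?_
  · intro a
    exact ⟨⟨.mk 0 a 0, (hP _).2 rfl⟩, rfl⟩
  · rintro ⟨⟨z, a, L⟩, hx⟩ ⟨⟨z', b, M⟩, hy⟩
    obtain rfl : L = 0 := (hP _).1 hx
    obtain rfl : M = 0 := (hP _).1 hy
    change ⁅a, b⁆ + c.ξ 0 b - c.ξ 0 a + c.α 0 0 = ⁅a, b⁆
    simp
  · rintro ⟨⟨z, a, L⟩, hx⟩ ⟨⟨z', b, M⟩, hy⟩
    obtain rfl : L = 0 := (hP _).1 hx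
    obtain rfl : M = 0 := (hP _).1 hy
    change A.form a b = z 0 + A.form a b - z' 0
    simp

lemma finrank_standardModel (hc : c.IsCocycle) :
    Module.finrank ℝ (c.standardModel hc) = 2 * Module.finrank ℝ l + Module.finrank ℝ A :=
  finrank_standardSpace

/-- Dimension count: the model has dimension `2 dim l + dim a`, and also `2 dim j + dim a` by its
reduction. -/
lemma finrank_canonicalIdeal_standardModel (hc : c.IsBalancedCocycle) :
    Module.finrank ℝ (c.standardModel hc.toIsCocycle).canonicalIdeal = Module.finrank ℝ l := by
  obtain ⟨e⟩ := nonempty_reduction_standardModel hc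
  have h1 := e.finrank_eq
  have h2 := finrank_standardModel hc.toIsCocycle
  have h3 := finrank_reduction (c.standardModel hc.toIsCocycle)
  omega

end QuadraticCochain

end
-- Reading a cocycle off a bracket.
noncomputable section

namespace QuadraticCochain

variable {l : Type w} [AddCommGroup l] [Module ℝ l] {A : SymplecticLieAlgebra.{u}}

/-- If the bracket on `l^* ⊕ a ⊕ l` given by a triple satisfies the Jacobi identity and the form
is closed, then the triple is a cocycle. -/
lemma isCocycle_of_jacobi (c : QuadraticCochain l A)
    (hJ : ∀ x y z, c.standardBracket x (c.standardBracket y z) =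
      c.standardBracket (c.standardBracket x y) z + c.standardBracket y (c.standardBracket x z))
    (hε : ∀ L₁ L₂ L₃ : l, c.ε L₁ L₂ L₃ + c.ε L₂ L₃ L₁ + c.ε L₃ L₁ L₂ = 0) : c.IsCocycle := by
  have hJ1 := fun x y z => congrArg (fun x : StandardSpace l A => x.1) (hJ x y z)
  have hJ2 := fun x y z => congrArg (fun x : StandardSpace l A => x.2.1) (hJ x y z)
  simp only [standardBracket_fst, standardBracket_mid, standardBracket_last,
    StandardSpace.add_fst, StandardSpace.add_mid] at hJ1 hJ2
  -- Each type of arguments yields two conditions, one from the `a`-component of Jacobi and one from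
  -- the `l^*`-component: `(L, a, b)` gives `derivation` and `β_γ`, `(L, M, a)` gives `curvature`
  -- and `dγ`, `(L, M, N)` gives `bianchi` and `γ_α`.
  refine ⟨fun L a b => ?_, fun L M a => ?_, fun L M N => ?_, fun L a b => ?_, fun L M a => ?_,
    fun L M N => ?_, hε⟩
  · simpa using hJ2 (.mk 0 0 L) (.mk 0 a 0) (.mk 0 b 0)
  · have := hJ2 (.mk 0 0 L) (.mk 0 0 M) (.mk 0 a 0)
    simp at this
    rw [this, add_sub_cancel_right]
  · have := hJ2 (.mk 0 0 L) (.mk 0 0 M) (.mk 0 0 N)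
    simp at this
    rw [this]
    abel
  · have := hJ1 (.mk 0 0 L) (.mk 0 a 0) (.mk 0 b 0)
    simp at this
    exact this.symm
  · have := hJ1 (.mk 0 0 L) (.mk 0 0 M) (.mk 0 a 0)
    simp at this
    rw [this]
    abel
  · have := hJ1 (.mk 0 0 L) (.mk 0 0 M) (.mk 0 0 N)
    simp at this
    rw [this, c.α_swap N L, map_neg]
    abel

section StandardSpace

/-- The inclusion of `a` into `l^* ⊕ a ⊕ l`. -/
def StandardSpace.inMid : A →ₗ[ℝ] StandardSpace l A where
  toFun a := .mk 0 a 0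
  map_add' _ _ := StandardSpace.ext' (by simp) (by simp) (by simp)
  map_smul' _ _ := StandardSpace.ext' (by simp) (by simp) (by simp)

/-- The inclusion of `l` into `l^* ⊕ a ⊕ l`. -/
def StandardSpace.inLast : l →ₗ[ℝ] StandardSpace l A where
  toFun L := .mk 0 0 L
  map_add' _ _ := StandardSpace.ext' (by simp) (by simp) (by simp)
  map_smul' _ _ := StandardSpace.ext' (by simp) (by simp) (by simp)

/-- The projection of `l^* ⊕ a ⊕ l` to `l^*`. -/
def StandardSpace.toFst : StandardSpace l A →ₗ[ℝ] Module.Dual ℝ l where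
  toFun x := x.1
  map_add' _ _ := rfl
  map_smul' _ _ := rfl

/-- The projection of `l^* ⊕ a ⊕ l` to `a`. -/
def StandardSpace.toMid : StandardSpace l A →ₗ[ℝ] A where
  toFun x := x.2.1
  map_add' _ _ := rfl
  map_smul' _ _ := rfl

lemma StandardSpace.eq_add (x : StandardSpace l A) :
    x = .mk x.1 0 0 + .mk 0 x.2.1 0 + .mk 0 0 x.2.2 :=
  StandardSpace.ext' (by simp) (by simp) (by simp)

end StandardSpace

/-- The triple read off from an alternating bilinear map on `l^* ⊕ a ⊕ l`. -/
def ofBracket (B : StandardSpace l A →ₗ[ℝ] StandardSpace l A →ₗ[ℝ] StandardSpace l A)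
    (hB : ∀ x, B x x = 0) : QuadraticCochain l A where
  γ := (B.compl₁₂ StandardSpace.inLast StandardSpace.inMid).compr₂ StandardSpace.toFst
  ε := (B.compl₁₂ StandardSpace.inLast StandardSpace.inLast).compr₂ StandardSpace.toFst
  ξ := (B.compl₁₂ StandardSpace.inLast StandardSpace.inMid).compr₂ StandardSpace.toMid
  ε_self _ := congrArg StandardSpace.toFst (hB _)

section

variable (B : StandardSpace l A →ₗ[ℝ] StandardSpace l A →ₗ[ℝ] StandardSpace l A)
  (hB : ∀ x, B x x = 0)

lemma ofBracket_γ (L : l) (a : A) :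
    (ofBracket B hB).γ L a = (B (.mk 0 0 L) (.mk 0 a 0)).1 := rfl

lemma ofBracket_ε (L M : l) :
    (ofBracket B hB).ε L M = (B (.mk 0 0 L) (.mk 0 0 M)).1 := rfl

lemma ofBracket_ξ (L : l) (a : A) :
    (ofBracket B hB).ξ L a = (B (.mk 0 0 L) (.mk 0 a 0)).2.1 := rfl

/-- Closedness leaves no freedom beyond the triple: evaluated on `(a, b, L)` it expresses the
`l^*`-part of `[a, b]` through `ξ`, and on `(L, M, a)` the `a`-part of `[L, M]` through `γ`. -/
lemma standardBracket_ofBracket (hz : ∀ z y, B (.mk z 0 0) y = 0)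
    (hA : ∀ a b : A, (B (.mk 0 a 0) (.mk 0 b 0)).2.1 = ⁅a, b⁆)
    (hl : ∀ x y, (B x y).2.2 = 0)
    (hω : ∀ x y z, -standardForm l A (B x y) z + standardForm l A (B x z) y -
      standardForm l A (B y z) x = 0) (x y : StandardSpace l A) :
    (ofBracket B hB).standardBracket x y = B x y := by
  have hs : ∀ x y, B x y = -B y x := by
    intro x y
    have h := hB (x + y)
    simp only [map_add, LinearMap.add_apply, hB, zero_add, add_zero] at h
    exact eq_neg_of_add_eq_zero_right h
  have hz' : ∀ z y, B y (.mk z 0 0) = 0 := fun z y => by rw [hs, hz, neg_zero]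
  have hβ : ∀ a b : A, (B (.mk 0 a 0) (.mk 0 b 0)).1 = (ofBracket B hB).β a b := by
    intro a b
    ext L
    have h := hω (.mk 0 a 0) (.mk 0 b 0) (.mk 0 0 L)
    rw [hs (.mk 0 a 0) (.mk 0 0 L), hs (.mk 0 b 0) (.mk 0 0 L)] at h
    have e := form_swap (B (.mk 0 0 L) (.mk 0 b 0)).2.1 a
    simp [standardForm_apply, ofBracket_ξ, hl] at h e ⊢
    linarith
  have hα : ∀ L M : l, (B (.mk 0 0 L) (.mk 0 0 M)).2.1 = (ofBracket B hB).α L M := by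
    intro L M
    refine eq_of_form fun a => ?_
    have h := hω (.mk 0 0 L) (.mk 0 0 M) (.mk 0 a 0)
    rw [form_α]
    simp [standardForm_apply, ofBracket_γ, hl] at h ⊢
    linarith
  have hx : B x y = B (.mk 0 x.2.1 0) (.mk 0 y.2.1 0) + B (.mk 0 0 x.2.2) (.mk 0 y.2.1 0) -
      B (.mk 0 0 y.2.2) (.mk 0 x.2.1 0) + B (.mk 0 0 x.2.2) (.mk 0 0 y.2.2) := by
    conv_lhs => rw [x.eq_add, y.eq_add]
    rw [sub_eq_add_neg, ← hs]
    simp only [map_add, LinearMap.add_apply, hz, hz']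
    abel
  rw [hx, sub_eq_add_neg]
  apply StandardSpace.ext'
  · simp only [standardBracket_fst, StandardSpace.add_fst, StandardSpace.neg_fst, hβ,
      ofBracket_γ, ofBracket_ε, sub_eq_add_neg]
  · simp only [standardBracket_mid, StandardSpace.add_mid, StandardSpace.neg_mid, hA,
      ofBracket_ξ, hα, sub_eq_add_neg]
  · simp [standardBracket_last, hl]

end

variable [FiniteDimensional ℝ l]

/-- The bracket of `g` is transported along `Θ`. The underlying map is recorded in the conclusion so
that canonical ideals can be compared afterwards. -/
lemma exists_standardModel_iso (g : SymplecticLieAlgebra.{v}) (Θ : StandardSpace l A ≃ₗ[ℝ] g)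
    (hf : ∀ x y, g.form (Θ x) (Θ y) = standardForm l A x y)
    (hz : ∀ z, Θ (.mk z 0 0) ∈ LieAlgebra.center ℝ g)
    (hA : ∀ a b : A, ∃ z, ⁅Θ (.mk 0 a 0), Θ (.mk 0 b 0)⁆ = Θ (.mk z ⁅a, b⁆ 0)) :
    ∃ (c : QuadraticCochain l A) (hc : c.IsCocycle) (e : Iso (c.standardModel hc) g),
      ∀ x, e.toLieEquiv x = Θ x := by
  let B : StandardSpace l A →ₗ[ℝ] StandardSpace l A →ₗ[ℝ] StandardSpace l A :=
    LinearMap.mk₂ ℝ (fun x y => Θ.symm ⁅Θ x, Θ y⁆) (by intros; simp) (by intros; simp)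
      (by intros; simp) (by intros; simp)
  have hBΘ : ∀ x y, Θ (B x y) = ⁅Θ x, Θ y⁆ := fun x y => Θ.apply_symm_apply _
  have hB : ∀ x, B x x = 0 := fun x => Θ.injective (by simp [hBΘ])
  have hsb : ∀ x y, (ofBracket B hB).standardBracket x y = B x y := by
    refine standardBracket_ofBracket B hB ?_ ?_ ?_ ?_
    · intro z y
      apply Θ.injective
      rw [hBΘ, map_zero]
      exact (mem_center_iff _).1 (hz z) _
    · intro a b
      obtain ⟨z, h⟩ := hA a b
      rw [← hBΘ] at h
      rw [Θ.injective h]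
      rfl
    · intro x y
      -- The center is orthogonal to all brackets; pairing with the central subspace `l^*` shows
      -- that brackets have no `l`-component.
      refine (Module.forall_dual_apply_eq_zero_iff ℝ _).1 fun z => ?_
      have h := form_lie_of_mem_center (Θ x) (Θ y) (hz z)
      rw [← hBΘ, hf, standardForm_apply] at h
      simpa using h
    · intro x y z
      simp only [← hf, hBΘ]
      exact g.closed _ _ _
  have hc : (ofBracket B hB).IsCocycle := by
    refine isCocycle_of_jacobi _ (fun x y z => ?_) fun L M N => ?_
    · simp only [hsb]
      apply Θ.injective
      simp only [hBΘ, map_add]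
      exact leibniz_lie _ _ _
    · have h := closed' (Θ (.mk 0 0 L)) (Θ (.mk 0 0 M)) (Θ (.mk 0 0 N))
      simp only [← hBΘ, hf] at h
      simp [standardForm_apply] at h
      simp only [ofBracket_ε]
      linarith
  refine ⟨_, hc, Iso.ofLinearEquiv (g := (ofBracket B hB).standardModel hc) Θ ?_ hf,
    fun _ => rfl⟩
  intro x y
  exact (congrArg Θ (hsb x y)).trans (hBΘ x y)

end QuadraticCochain

/-! ### Symplectic frames adapted to the canonical ideal. -/

namespace SymplecticLieAlgebra

/-- If `dim l = dim j` and `j^⊥ / j` is isomorphic to `a`, then `l^* ⊕ a ⊕ l` is linearly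
symplectomorphic to `g` in such a way that `l^*` corresponds to `j` and the bracket of elements
of `a` is preserved modulo `j`. -/
lemma exists_frame (g : SymplecticLieAlgebra.{v}) {A : SymplecticLieAlgebra.{u}}
    (e : Iso g.reduction A) (l : Type w) [AddCommGroup l] [Module ℝ l] [FiniteDimensional ℝ l]
    (hl : Module.finrank ℝ g.canonicalIdeal = Module.finrank ℝ l) :
    ∃ Θ : StandardSpace l A ≃ₗ[ℝ] g,
      (∀ x y, g.form (Θ x) (Θ y) = standardForm l A x y) ∧
      (∀ x, Θ x ∈ g.canonicalIdeal ↔ x.2.1 = 0 ∧ x.2.2 = 0) ∧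
      ∀ a b : A, ∃ z, ⁅Θ (.mk 0 a 0), Θ (.mk 0 b 0)⁆ = Θ (.mk z ⁅a, b⁆ 0) := by
  let P := g.canonicalPerp.toSubmodule
  let J := g.canonicalIdeal.toSubmodule
  let π : P →ₗ[ℝ] A := e.toLieEquiv.toLinearEquiv.toLinearMap ∘ₗ
    (Submodule.mkQ g.canonicalIdealInPerp.toSubmodule)
  have hπ : Function.Surjective π :=
    e.toLieEquiv.surjective.comp (Submodule.mkQ_surjective _)
  have hπf : ∀ x y : P, A.form (π x) (π y) = g.form x.1 y.1 := fun x y => e.map_form _ _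
  have hπl : ∀ x y : g.canonicalPerp, π ⁅x, y⁆ = ⁅π x, π y⁆ := fun x y =>
    e.map_lie (Submodule.mkQ _ x) (Submodule.mkQ _ y)
  have hπ0 : ∀ x : P, π x = 0 → x.1 ∈ J := by
    intro x hx
    have : Submodule.mkQ g.canonicalIdealInPerp.toSubmodule x = 0 :=
      e.toLieEquiv.toLinearEquiv.map_eq_zero_iff.1 hx
    exact (Submodule.Quotient.mk_eq_zero g.canonicalIdealInPerp.toSubmodule).1 this
  obtain ⟨s, hs⟩ := π.exists_rightInverse_of_surjective (LinearMap.range_eq_top.2 hπ)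
  have hs : ∀ a, π (s a) = a := fun a => LinearMap.congr_fun hs a
  have hsf : ∀ a b, g.form (s a).1 (s b).1 = A.form a b := fun a b => by rw [← hπf, hs, hs]
  have hJP : ∀ x ∈ J, ∀ y ∈ P, g.form x y = 0 := fun x hx y hy => hy x hx
  have hJJ : J ≤ P := canonicalIdeal_le_canonicalPerp
  let k : Module.Dual ℝ l ≃ₗ[ℝ] J := LinearEquiv.ofFinrankEq _ _ (by
    rw [Subspace.dual_finrank_eq]; exact hl.symm)
  -- A lift of `l ≅ l^{**}` through `g → l^{**}`, which is onto because `k` is injective and `ω`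
  -- non-degenerate. It is dual to `k`, but neither isotropic nor orthogonal to `s(a)` in general.
  obtain ⟨t₀, ht₀⟩ : ∃ t₀ : l →ₗ[ℝ] g, ∀ z L, g.form (k z).1 (t₀ L) = z L := by
    let f : g →ₗ[ℝ] Module.Dual ℝ (Module.Dual ℝ l) :=
      (g.form ∘ₗ J.subtype ∘ₗ k.toLinearMap).flip
    have hf : Function.Surjective f := by
      refine LinearMap.flip_surjective_iff₁.2 ?_
      refine (injective_iff_map_eq_zero _).2 fun z hz => ?_
      have h : (k z).1 = 0 := g.nondegenerate.1 _ fun y => LinearMap.congr_fun hz y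
      exact k.map_eq_zero_iff.1 (Subtype.ext h)
    obtain ⟨r, hr⟩ := f.exists_rightInverse_of_surjective (LinearMap.range_eq_top.2 hf)
    refine ⟨r ∘ₗ Module.Dual.eval ℝ l, fun z L => ?_⟩
    exact LinearMap.congr_fun (LinearMap.congr_fun hr (Module.Dual.eval ℝ l L)) z
  -- First correction, Gram–Schmidt against `s(a)`. It lies in `j^⊥`, so the pairing with `j` is
  -- unchanged.
  let d : l →ₗ[ℝ] A := A.dualOfToDual ((g.form.flip ∘ₗ t₀).flip ∘ₗ P.subtype ∘ₗ s)
  let t₁ : l →ₗ[ℝ] g := t₀ + P.subtype ∘ₗ s ∘ₗ d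
  have ht₁ : ∀ z L, g.form (k z).1 (t₁ L) = z L := by
    intro z L
    change g.form (k z).1 (t₀ L + (s (d L)).1) = z L
    rw [map_add, ht₀, hJP _ (k z).2 _ (s (d L)).2, add_zero]
  have ht₁s : ∀ a L, g.form (s a).1 (t₁ L) = 0 := by
    intro a L
    have h : A.form (d L) a = g.form (s a).1 (t₀ L) := form_dualOfToDual _ _ _
    change g.form (s a).1 (t₀ L + (s (d L)).1) = 0
    rw [map_add, hsf, form_swap a, h, add_neg_cancel]
  -- Second correction, by elements of `j`, to make the complement isotropic. It changes `ω(t₁ L, t₁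
  -- M)` by `q L M - q M L`, so half of the negative form is right.
  let q : l →ₗ[ℝ] Module.Dual ℝ l := (-(1 / 2) : ℝ) • g.form.compl₁₂ t₁ t₁
  have hq : ∀ L M, q L M = -(1 / 2) * g.form (t₁ L) (t₁ M) := fun _ _ => rfl
  let t : l →ₗ[ℝ] g := t₁ + J.subtype ∘ₗ k.toLinearMap ∘ₗ q
  have ht : ∀ L, t L = t₁ L + (k (q L)).1 := fun _ => rfl
  have hkt : ∀ z L, g.form (k z).1 (t L) = z L := by
    intro z L
    rw [ht, map_add, ht₁, hJP _ (k z).2 _ (hJJ (k _).2), add_zero]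
  have hst : ∀ a L, g.form (s a).1 (t L) = 0 := by
    intro a L
    rw [ht, map_add, ht₁s, form_swap, hJP _ (k _).2 _ (s a).2]
    simp
  have htt : ∀ L M, g.form (t L) (t M) = 0 := by
    intro L M
    rw [ht M, map_add, form_swap (t L) (k _).1, hkt, ht L, map_add, LinearMap.add_apply, ht₁,
      hq, hq, form_swap (t₁ M)]
    ring
  let T : StandardSpace l A →ₗ[ℝ] g :=
    { toFun := fun x => (k x.1).1 + (s x.2.1).1 + t x.2.2
      map_add' := fun x y => by
        simp only [StandardSpace.add_fst, StandardSpace.add_mid, StandardSpace.add_last, map_add,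
          Submodule.coe_add]
        abel
      map_smul' := fun r x => by
        simp only [StandardSpace.smul_fst, StandardSpace.smul_mid, StandardSpace.smul_last,
          map_smul, Submodule.coe_smul, smul_add, RingHom.id_apply] }
  have hT : ∀ x, T x = (k x.1).1 + (s x.2.1).1 + t x.2.2 := fun _ => rfl
  have hTf : ∀ x y, g.form (T x) (T y) = standardForm l A x y := by
    intro x y
    have h1 := form_swap (t x.2.2) (k y.1).1
    have h2 := form_swap (t x.2.2) (s y.2.1).1
    have h3 := form_swap (s x.2.1).1 (k y.1).1
    rw [hkt] at h1
    rw [hst] at h2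
    rw [hJP _ (k _).2 _ (s _).2] at h3
    simp only [hT, map_add, LinearMap.add_apply, hkt, hst, htt, hsf, h1, h2, h3,
      hJP _ (k _).2 _ (s _).2, hJP _ (k _).2 _ (hJJ (k _).2), standardForm_apply]
    ring
  have hTi : Function.Injective T := by
    refine (injective_iff_map_eq_zero T).2 fun x hx => ?_
    refine (standardForm_nondegenerate (l := l) (A := A)).1 x fun y => ?_
    rw [← hTf, hx, map_zero, LinearMap.zero_apply]
  have hd : Module.finrank ℝ (StandardSpace l A) = Module.finrank ℝ g := by
    rw [finrank_standardSpace, ← e.finrank_eq, ← hl, ← finrank_reduction g]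
    ring
  let Θ := LinearEquiv.ofInjectiveOfFinrankEq T hTi hd
  have hΘ : ∀ x, Θ x = T x := fun _ => rfl
  refine ⟨Θ, hTf, fun x => ⟨fun hx => ?_, ?_⟩, fun a b => ?_⟩
  · have h : ∀ y, standardForm l A (.mk (k.symm ⟨Θ x, hx⟩) 0 0) y = standardForm l A x y := by
      intro y
      rw [← hTf, ← hTf, hT]
      simp [hΘ]
    have hx' := eq_of_sub_eq_zero ((standardForm_nondegenerate (l := l) (A := A)).1
      (x - .mk (k.symm ⟨Θ x, hx⟩) 0 0) fun y => by
        rw [map_sub, LinearMap.sub_apply, h, sub_self])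
    exact ⟨congrArg (fun y : StandardSpace l A => y.2.1) hx',
      congrArg (fun y : StandardSpace l A => y.2.2) hx'⟩
  · rintro ⟨h1, h2⟩
    rw [hΘ, hT, h1, h2, map_zero, map_zero]
    simp
  · let br : g.canonicalPerp := ⁅(show g.canonicalPerp from s a), (show g.canonicalPerp from s b)⁆
    have hbr : π br = ⁅a, b⁆ := (hπl (s a) (s b)).trans (by rw [hs, hs])
    have h : ⁅(s a).1, (s b).1⁆ - (s ⁅a, b⁆).1 ∈ J :=
      hπ0 (br - s ⁅a, b⁆) (by rw [map_sub, hs, hbr, sub_self])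
    refine ⟨k.symm ⟨_, h⟩, ?_⟩
    rw [hΘ, hΘ, hΘ, hT, hT, hT]
    simp

/-- A symplectic Lie algebra is isomorphic to the standard model of a balanced cocycle. -/
lemma exists_isBalancedCocycle (g : SymplecticLieAlgebra.{v}) {A : SymplecticLieAlgebra.{u}}
    (e : Iso g.reduction A) (l : Type w) [AddCommGroup l] [Module ℝ l] [FiniteDimensional ℝ l]
    (hl : Module.finrank ℝ g.canonicalIdeal = Module.finrank ℝ l) :
    ∃ (c : QuadraticCochain l A) (hc : c.IsBalancedCocycle),
      Nonempty (Iso (c.standardModel hc.toIsCocycle) g) := by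
  obtain ⟨Θ, hf, hj, hA⟩ := g.exists_frame e l hl
  obtain ⟨c, hc, e', he'⟩ := exists_standardModel_iso g Θ hf
    (fun z => ((hj (.mk z 0 0)).2 ⟨rfl, rfl⟩).1) hA
  -- Balancedness costs nothing: isomorphisms preserve canonical ideals, and the frame matches `j`
  -- with `l^*`.
  refine ⟨c, (isBalancedCocycle_iff hc).2 fun x => ?_, ⟨e'⟩⟩
  rw [← e'.mem_canonicalIdeal_iff, he']
  exact hj x

end SymplecticLieAlgebra

end
-- Isomorphic standard models come from one orbit.
noncomputable section

namespace QuadraticCochain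

variable {l : Type w} [AddCommGroup l] [Module ℝ l] {A : SymplecticLieAlgebra.{u}}

lemma ext_of_standardBracket {c c' : QuadraticCochain l A}
    (h : ∀ x y, c.standardBracket x y = c'.standardBracket x y) : c = c' := by
  have h1 := fun x y => congrArg (fun x : StandardSpace l A => x.1) (h x y)
  have h2 := fun x y => congrArg (fun x : StandardSpace l A => x.2.1) (h x y)
  simp only [standardBracket_fst, standardBracket_mid] at h1 h2
  ext L₁ L₂ L₃
  · have := h1 (.mk 0 0 L₁) (.mk 0 L₂ 0)
    simp at this
    rw [this]
  · have := h1 (.mk 0 0 L₁) (.mk 0 0 L₂)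
    simp at this
    rw [this]
  · simpa using h2 (.mk 0 0 L₁) (.mk 0 L₂ 0)

/-- A linear symplectic automorphism that induces the identity on `a` and `l` and is compatible
with the brackets of two triples forces the triples to coincide. -/
lemma eq_of_standardBracket_map {c c' : QuadraticCochain l A}
    (H : StandardSpace l A →ₗ[ℝ] StandardSpace l A)
    (hb : ∀ x y, H (c.standardBracket x y) = c'.standardBracket (H x) (H y))
    (hf : ∀ x y, standardForm l A (H x) (H y) = standardForm l A x y)
    (hmid : ∀ x, (H x).2.1 = x.2.1) (hlast : ∀ x, (H x).2.2 = x.2.2) : c = c' := by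
  refine ext_of_standardBracket fun x y => ?_
  -- Pairing with `l` shows that `H` fixes `l^* ⊕ a`, where all brackets lie. Brackets also ignore
  -- the `l^*`-components of their arguments, so `H` drops out of the identity `hb`.
  have h1 : ∀ x, x.2.2 = 0 → H x = x := by
    intro x hx
    refine StandardSpace.ext' (LinearMap.ext fun L => ?_) (hmid x) (hlast x)
    have h := hf x (.mk 0 0 L)
    simp only [standardForm_apply, hmid, hlast, hx] at h
    simpa using h
  have h2 : c'.standardBracket (H x) (H y) = c'.standardBracket x y := by
    simp only [standardBracket, hmid, hlast]
    rfl
  rw [← h2, ← hb, h1 _ rfl]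

/-- Let `τ` be the `a`-component of `G` on `l`. Undoing the shear along `τ` leaves a map that is
trivial on the `a`- and `l`-components, and such a map does not affect the triple. -/
lemma exists_eq_act_of_unipotent {c c' : QuadraticCochain l A}
    (G : StandardSpace l A →ₗ[ℝ] StandardSpace l A)
    (hb : ∀ x y, G (c.standardBracket x y) = c'.standardBracket (G x) (G y))
    (hf : ∀ x y, standardForm l A (G x) (G y) = standardForm l A x y)
    (hmid : ∀ x, x.2.2 = 0 → (G x).2.1 = x.2.1) (hlast : ∀ x, (G x).2.2 = x.2.2) :
    ∃ τ : l →ₗ[ℝ] A, c = c'.act τ := by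
  let τ : l →ₗ[ℝ] A := StandardSpace.toMid ∘ₗ G ∘ₗ StandardSpace.inLast
  have hτ : ∀ L, τ L = (G (.mk 0 0 L)).2.1 := fun _ => rfl
  have hs : ∀ x, shear τ ((shear τ).symm (G x)) = G x := fun x => (shear τ).apply_symm_apply _
  refine ⟨-τ, eq_of_standardBracket_map ((shear τ).symm.toLinearMap ∘ₗ G) ?_ ?_ ?_ ?_⟩
  · intro x y
    apply (shear τ).injective
    rw [shear_standardBracket]
    simp only [LinearMap.comp_apply, LinearEquiv.coe_coe, hs, hb, LinearEquiv.apply_symm_apply]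
  · intro x y
    rw [← standardForm_shear τ]
    simp only [LinearMap.comp_apply, LinearEquiv.coe_coe, hs, hf]
  · intro x
    change (G x).2.1 - τ (G x).2.2 = x.2.1
    have h : (G x).2.1 = (G (.mk x.1 0 0)).2.1 + (G (.mk 0 x.2.1 0)).2.1 +
        (G (.mk 0 0 x.2.2)).2.1 := by
      conv_lhs => rw [x.eq_add, map_add, map_add]
      rfl
    rw [h, hmid _ rfl, hmid _ rfl, hlast, hτ]
    simp
  · intro x
    exact hlast x

lemma exists_pullback_eq_act [FiniteDimensional ℝ l] {c c' : QuadraticCochain l A}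
    (hc : c.IsBalancedCocycle) (hc' : c'.IsBalancedCocycle)
    (φ : Iso (c.standardModel hc.toIsCocycle) (c'.standardModel hc'.toIsCocycle)) :
    ∃ (S : l ≃ₗ[ℝ] l) (U : Iso A A) (τ : l →ₗ[ℝ] A), c = (c'.pullback S U).act τ := by
  let F : StandardSpace l A →ₗ[ℝ] StandardSpace l A := φ.toLieEquiv.toLinearEquiv.toLinearMap
  have hFb : ∀ x y, F (c.standardBracket x y) = c'.standardBracket (F x) (F y) :=
    fun x y => φ.map_lie x y
  have hFf : ∀ x y, standardForm l A (F x) (F y) = standardForm l A x y :=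
    fun x y => φ.map_form x y
  have hFj : ∀ x, ((F x).2.1 = 0 ∧ (F x).2.2 = 0) ↔ x.2.1 = 0 ∧ x.2.2 = 0 := fun x =>
    ((isBalancedCocycle_iff hc'.toIsCocycle).1 hc' (F x)).symm.trans
      ((φ.mem_canonicalIdeal_iff x).trans ((isBalancedCocycle_iff hc.toIsCocycle).1 hc x))
  have hFp : ∀ x, (F x).2.2 = 0 ↔ x.2.2 = 0 := fun x =>
    (mem_canonicalPerp_standardModel_iff hc' (F x)).symm.trans
      ((φ.mem_canonicalPerp_iff x).trans (mem_canonicalPerp_standardModel_iff hc x))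
  -- The two diagonal blocks: `S` is induced on the quotient by `j^⊥`, and `U` below on `j^⊥ / j`.
  -- Injectivity holds because `φ` preserves and reflects `j^⊥` and `j`.
  let S₀ : l →ₗ[ℝ] l :=
    { toFun := fun L => (F (StandardSpace.inLast L)).2.2
      map_add' := fun _ _ => by simp
      map_smul' := fun _ _ => by simp }
  let S : l ≃ₗ[ℝ] l := LinearEquiv.ofInjectiveEndo S₀
    ((injective_iff_map_eq_zero S₀).2 fun L hL => (hFp (.mk 0 0 L)).1 hL)
  have hS : ∀ x, (F x).2.2 = S x.2.2 := by
    intro x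
    have h : (F (x - .mk 0 0 x.2.2)).2.2 = 0 :=
      (hFp _).2 (sub_self (x.2.2))
    rw [map_sub] at h
    exact sub_eq_zero.1 h
  let U₀ : A →ₗ[ℝ] A := StandardSpace.toMid ∘ₗ F ∘ₗ StandardSpace.inMid
  have hU₀ : ∀ x, x.2.2 = 0 → (F x).2.1 = U₀ x.2.1 := by
    intro x hx
    have h := (hFj (x - StandardSpace.mk 0 x.2.1 0)).2 ⟨sub_self x.2.1, (sub_zero x.2.2).trans hx⟩
    rw [map_sub] at h
    exact sub_eq_zero.1 h.1
  let U₁ : A ≃ₗ[ℝ] A := LinearEquiv.ofInjectiveEndo U₀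
    ((injective_iff_map_eq_zero U₀).2 fun a ha =>
      ((hFj (.mk 0 a 0)).1 ⟨ha, (hFp (.mk 0 a 0)).2 rfl⟩).1)
  have hl : ∀ a : A, (F (.mk 0 a 0)).2.2 = 0 := fun a => (hFp _).2 rfl
  let U : Iso A A := Iso.ofLinearEquiv U₁
    (fun a b => by
      have h := congrArg (fun x : StandardSpace l A => x.2.1) (hFb (.mk 0 a 0) (.mk 0 b 0))
      simp only [hU₀ _ (standardBracket_last _ _ _), standardBracket_mid, hl] at h
      rw [hU₀ (.mk 0 a 0) rfl, hU₀ (.mk 0 b 0) rfl] at h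
      simp at h
      exact h)
    (fun a b => by
      have h := hFf (.mk 0 a 0) (.mk 0 b 0)
      simp only [standardForm_apply, hl] at h
      rw [hU₀ (.mk 0 a 0) rfl, hU₀ (.mk 0 b 0) rfl] at h
      simp at h
      exact h)
  have hE : ∀ x, blockEquiv S U.symm ((blockEquiv S U.symm).symm (F x)) = F x :=
    fun x => (blockEquiv S U.symm).apply_symm_apply _
  -- `blockEquiv` applies the inverse of its second argument to `a`, hence `U.symm`. Dividing `F` by
  -- this block map leaves a unipotent map.
  refine ⟨S, U.symm, exists_eq_act_of_unipotent
    ((blockEquiv S U.symm).symm.toLinearMap ∘ₗ F) ?_ ?_ ?_ ?_⟩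
  · intro x y
    apply (blockEquiv S U.symm).injective
    rw [blockEquiv_standardBracket]
    simp only [LinearMap.comp_apply, LinearEquiv.coe_coe, hE, hFb, LinearEquiv.apply_symm_apply]
  · intro x y
    rw [← standardForm_blockEquiv S U.symm]
    simp only [LinearMap.comp_apply, LinearEquiv.coe_coe, hE, hFf]
  · intro x hx
    apply U.toLieEquiv.injective
    refine (congrArg (fun x : StandardSpace l A => x.2.1) (hE x)).trans ?_
    exact hU₀ x hx
  · intro x
    apply S.injective
    exact (congrArg (fun x : StandardSpace l A => x.2.2) (hE x)).trans (hS x)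

/-- The orbits of two balanced cocycles agree if and only if their standard models are
isomorphic. -/
lemma orbit_eq_iff [FiniteDimensional ℝ l] {c c' : QuadraticCochain l A}
    (hc : c.IsBalancedCocycle) (hc' : c'.IsBalancedCocycle) :
    orbit c hc = orbit c' hc' ↔
      Nonempty (Iso (c.standardModel hc.toIsCocycle) (c'.standardModel hc'.toIsCocycle)) := by
  refine ⟨nonempty_iso_of_orbit_eq hc hc', fun ⟨φ⟩ => ?_⟩
  obtain ⟨S, U, τ, h⟩ := exists_pullback_eq_act hc hc' φ
  exact orbit_eq_of_pullback_eq_act hc hc' S U τ h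

lemma exists_orbit_eq (o : OrbitSpace l A) :
    ∃ (c : QuadraticCochain l A) (hc : c.IsBalancedCocycle), orbit c hc = o := by
  induction o using Quotient.inductionOn with
  | _ q =>
    obtain ⟨_, c, hc, rfl⟩ := q
    exact ⟨c, hc, rfl⟩

/-! ### The classifying map on orbits. -/

section

variable {l : Type} [AddCommGroup l] [Module ℝ l] [FiniteDimensional ℝ l]
  {A : SymplecticLieAlgebra.{u}}

/-- The isomorphism class of the standard models given by an orbit. -/
def modelClass (o : OrbitSpace l A) : IsoClass.{u} :=
  ((exists_orbit_eq o).choose.standardModel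
    (exists_orbit_eq o).choose_spec.choose.toIsCocycle).isoClass

/-- The representative chosen in `modelClass` is immaterial by `orbit_eq_iff`. As `l` lives in
`Type`, the models stay in the universe of `A`. -/
lemma modelClass_orbit (c : QuadraticCochain l A) (hc : c.IsBalancedCocycle) :
    modelClass (orbit c hc) = (c.standardModel hc.toIsCocycle).isoClass :=
  Quotient.sound ((orbit_eq_iff _ _).1 (exists_orbit_eq (orbit c hc)).choose_spec.choose_spec)

lemma modelClass_injective : Function.Injective (modelClass (l := l) (A := A)) := by
  intro o o' h
  obtain ⟨c, hc, rfl⟩ := exists_orbit_eq o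
  obtain ⟨c', hc', rfl⟩ := exists_orbit_eq o'
  rw [modelClass_orbit, modelClass_orbit] at h
  exact (orbit_eq_iff hc hc').2 (Quotient.exact h)

lemma exists_modelClass_eq (g : SymplecticLieAlgebra.{u})
    (hl : Module.finrank ℝ g.canonicalIdeal = Module.finrank ℝ l)
    (e : Iso g.reduction A) : ∃ o : OrbitSpace l A, modelClass o = g.isoClass := by
  obtain ⟨c, hc, e'⟩ := g.exists_isBalancedCocycle e l hl
  exact ⟨orbit c hc, (modelClass_orbit c hc).trans (Quotient.sound e')⟩

end

end QuadraticCochain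

end

/-! ### The two bijections. -/

theorem mainTheorem1 :
    (∀ (A : SymplecticLieAlgebra.{u}) (n : ℕ),
      ∃ Φ : OrbitSpace (Fin n → ℝ) A ≃
          {q : IsoClass.{u} // ∃ g : SymplecticLieAlgebra.{u}, g.isoClass = q ∧
            Module.finrank ℝ g.canonicalIdeal = n ∧ Nonempty (Iso g.reduction A)},
        ∀ (c : QuadraticCochain (Fin n → ℝ) A) (hc : c.IsBalancedCocycle),
          (Φ (orbit c hc)).1 = (c.standardModel hc.toIsCocycle).isoClass) ∧
    (∀ Isom : ℕ → Set SymplecticLieAlgebra.{u},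
      (∀ d : ℕ, IsSystemOfRepresentatives (2 * d) (Isom (2 * d))) →
      ∀ n : ℕ,
        ∃ Ψ : (Σ m : Set.Icc 1 n, Σ A : Isom (2 * n - 2 * m.1), OrbitSpace (Fin m.1 → ℝ) A.1) ≃
            {q : IsoClass.{u} // ∃ g : SymplecticLieAlgebra.{u}, g.isoClass = q ∧
              Module.finrank ℝ g = 2 * n ∧ g.HasDegenerateCenter},
          ∀ (m : Set.Icc 1 n) (A : Isom (2 * n - 2 * m.1))
            (c : QuadraticCochain (Fin m.1 → ℝ) A.1) (hc : c.IsBalancedCocycle),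
            (Ψ ⟨m, A, orbit c hc⟩).1 = (c.standardModel hc.toIsCocycle).isoClass) := by
  refine ⟨fun A n => ?_, fun Isom hI n => ?_⟩
  · let f : OrbitSpace (Fin n → ℝ) A → {q : IsoClass.{u} // ∃ g : SymplecticLieAlgebra.{u},
        g.isoClass = q ∧ Module.finrank ℝ g.canonicalIdeal = n ∧
          Nonempty (Iso g.reduction A)} := fun o => ⟨modelClass o, by
      obtain ⟨c, hc, rfl⟩ := exists_orbit_eq o
      refine ⟨c.standardModel hc.toIsCocycle, (modelClass_orbit c hc).symm, ?_,
        nonempty_reduction_standardModel hc⟩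
      rw [finrank_canonicalIdeal_standardModel hc, Module.finrank_fin_fun]⟩
    refine ⟨Equiv.ofBijective f ⟨?_, ?_⟩, modelClass_orbit⟩
    · intro o o' h
      exact modelClass_injective (congrArg Subtype.val h)
    · rintro ⟨_, g, rfl, hg, ⟨e⟩⟩
      obtain ⟨o, ho⟩ := exists_modelClass_eq (l := Fin n → ℝ) g
        (by rw [hg, Module.finrank_fin_fun]) e
      exact ⟨o, Subtype.ext ho⟩
  · have hI' : ∀ m : Set.Icc 1 n,
        IsSystemOfRepresentatives (2 * n - 2 * m.1) (Isom (2 * n - 2 * m.1)) := fun m => by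
      rw [← Nat.mul_sub]
      exact hI _
    let f : (Σ m : Set.Icc 1 n, Σ A : Isom (2 * n - 2 * m.1), OrbitSpace (Fin m.1 → ℝ) A.1) →
        {q : IsoClass.{u} // ∃ g : SymplecticLieAlgebra.{u}, g.isoClass = q ∧
          Module.finrank ℝ g = 2 * n ∧ g.HasDegenerateCenter} :=
      fun x => ⟨modelClass x.2.2, by
        obtain ⟨m, A, o⟩ := x
        obtain ⟨c, hc, rfl⟩ := exists_orbit_eq o
        refine ⟨c.standardModel hc.toIsCocycle, (modelClass_orbit c hc).symm, ?_, ?_⟩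
        · rw [finrank_standardModel, Module.finrank_fin_fun, (hI' m).1 A.1 A.2]
          -- The bound `m ≤ n` makes the truncated subtraction `2 * n - 2 * m` exact.
          have := m.2.2
          omega
        · rw [hasDegenerateCenter_iff, finrank_canonicalIdeal_standardModel hc,
            Module.finrank_fin_fun]
          exact Nat.one_le_iff_ne_zero.1 m.2.1⟩
    refine ⟨Equiv.ofBijective f ⟨?_, ?_⟩, fun m A => modelClass_orbit⟩
    · rintro ⟨⟨m, hm⟩, ⟨A, hA⟩, o⟩ ⟨⟨m', hm'⟩, ⟨A', hA'⟩, o'⟩ h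
      replace h : modelClass o = modelClass o' := congrArg Subtype.val h
      obtain ⟨c, hc, rfl⟩ := exists_orbit_eq o
      obtain ⟨c', hc', rfl⟩ := exists_orbit_eq o'
      have h' := h
      rw [modelClass_orbit, modelClass_orbit] at h'
      obtain ⟨φ⟩ : Nonempty (Iso _ _) := Quotient.exact h'
      -- The indices must agree before orbits can be compared: `dim j` recovers `m`, and the
      -- reduction recovers `A` by uniqueness of representatives.
      have hmm := φ.finrank_canonicalIdeal_eq
      rw [finrank_canonicalIdeal_standardModel hc, finrank_canonicalIdeal_standardModel hc',
        Module.finrank_fin_fun, Module.finrank_fin_fun] at hmm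
      subst hmm
      obtain ⟨r⟩ := φ.nonempty_reduction
      obtain ⟨e⟩ := nonempty_reduction_standardModel hc
      obtain ⟨e'⟩ := nonempty_reduction_standardModel hc'
      have hAA : A = A' := ((hI' ⟨m, hm⟩).2 A ((hI' ⟨m, hm⟩).1 A hA)).unique
        ⟨hA, ⟨Iso.refl A⟩⟩ ⟨hA', ⟨(e.symm.trans r).trans e'⟩⟩
      subst hAA
      rw [modelClass_injective h]
    · rintro ⟨_, g, rfl, hg, hd⟩
      rw [hasDegenerateCenter_iff] at hd
      have hr := finrank_reduction g
      -- The index is `dim j`: at least `1` by degeneracy, and at most `n` since `2 dim j ≤ dim g =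
      -- 2n`.
      let m : Set.Icc 1 n := ⟨Module.finrank ℝ g.canonicalIdeal, by constructor <;> omega⟩
      obtain ⟨A, ⟨hA, ⟨e⟩⟩, -⟩ := (hI' m).2 g.reduction (by
        change _ = 2 * n - 2 * Module.finrank ℝ g.canonicalIdeal
        omega)
      obtain ⟨o, ho⟩ := exists_modelClass_eq (l := Fin m.1 → ℝ) g
        (by rw [Module.finrank_fin_fun]) e
      exact ⟨⟨m, ⟨A, hA⟩, o⟩, Subtype.ext ho⟩
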